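/- **Lemma 3.3 (Path differentiability of the solution map).** *Notions.* A set-valued map $\mathcal A:\mathbb R^n\rightrightarrows\mathbb R^n$ is monotone if $\langle u-v,x-y\rangle\ge 0$ whenever $u\in\mathcal A(x)$, $v\in\mathcal A(y)$, and maximal monotone if, in addition, its graph is not contained in the graph of any other monotone map. Its resolvent is $\mathcal R_{\mathcal A}=(\mathrm{Id}+\mathcal A)^{-1}$. For a locally Lipschitz function $f:\Omega\to\mathbb R^m$ on an open set $\Omega\subset\mathbb R^d$: - the Clarke Jacobian $\mathrm{Jac}^c_f(x)$ is the convex hull of all limits $\lim_k \mathrm{Jac}_f(x_k)$ with $x_k\to x$ and $f$ differentiable at each $x_k$; - a conservative Jacobian for $f$ is a set-valued map $\mathcal J:\Omega\rightrightarrows\mathbb R^{m\times d}$ with nonempty values, locally bounded, with closed graph (relative to $\Omega\times\mathbb R^{m\times d}$), such that for every absolutely continuous curve $c:[0,1]\to\Omega$ and for almost every $t\in[0,1]$ one has $\frac{d}{dt}f(c(t))=M\dot c(t)$ for all $M\in\mathcal J(c(t))$; - $f$ is path differentiable on $\Omega$ if it admits a conservative Jacobian. *Setting.* Let $\Theta\subset\mathbb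 R^p$ be a nonempty connected open set, $\gamma>0$, $\mathcal A:\Theta\times\mathbb R^n\rightrightarrows\mathbb R^n$ and $\mathcal B:\Theta\times\mathbb R^n\to\mathbb R^n$. Write $\mathcal A_\theta=\mathcal A(\theta,\cdot)$, $\mathcal B_\theta=\mathcal B(\theta,\cdot)$. Assume that 1. for every $\theta\in\Theta$, $\mathcal A_\theta$ is maximal monotone, $\mathcal B_\theta$ is maximal monotone and locally Lipschitz, and the inclusion $0\in\mathcal A_\theta(x)+\mathcal B_\theta(x)$ has a solution $x\in\mathbb R^n$; 2. the maps $T(\theta,x):=\mathcal R_{\gamma\mathcal A_\theta}(x)$ and $\mathcal B$ are locally Lipschitz and path differentiable on $\Theta\times\mathbb R^n$, jointly in $(\theta,x)$. For $(\theta,x)\in\Theta\times\mathbb R^n$ put $$\mathcal J_{x,H}(\theta,x)=\{V(I-\gamma Z):\ [U\ V]\in\mathrm{Jac}^c_T(\theta,x-\gamma\mathcal B_\theta(x)),\ [W\ Z]\in\mathrm{Jac}^c_{\mathcal B}(\theta,x)\},$$ where $U,W\in\mathbb R^{n\times p}$ and $V,Z\in\mathbb R^{n\times n}$. Assume finally (contractivity)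 that for every $\theta\in\Theta$ there is a solution $x$ of $0\in\mathcal A_\theta(x)+\mathcal B_\theta(x)$ with $$\|\mathcal J_{x,H}(\theta,x)\|_{\mathrm{op}}:=\sup_{K\in\mathcal J_{x,H}(\theta,x)}\|K\|_{\mathrm{op}}<1 .$$ *Conclusion.* For every $\theta\in\Theta$ the inclusion $0\in\mathcal A_\theta(x)+\mathcal B_\theta(x)$ has exactly one solution $x^\star(\theta)$. The map $x^\star:\Theta\to\mathbb R^n$ is path differentiable on $\Theta$ and, for all $\theta\in\Theta$, $[U\ V]\in\mathrm{Jac}^c_T(\theta,x^\star(\theta)-\gamma\mathcal B_\theta(x^\star(\theta)))$ and $[W\ Z]\in\mathrm{Jac}^c_{\mathcal B}(\theta,x^\star(\theta))$, the matrix $I-V(I-\gamma Z)$ is invertible. Moreover, $$\theta\mapsto\{(I-V(I-\gamma Z))^{-1}(U-\gamma VW):\ [U\ V]\in\mathrm{Jac}^c_T(\theta,x^\star(\theta)-\gamma\mathcal B_\theta(x^\star(\theta))),\ [W\ Z]\in\mathrm{Jac}^c_{\mathcal B}(\theta,x^\star(\theta))\}$$ is a conservative Jacobian for $x^\star$ on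 $\Theta$. -/

import Mathlib

open Set Filter Topology MeasureTheory
open scoped Pointwise ENNReal

/-- `A : X ⇉ X` (a map into subsets) is monotone. -/
def IsMonotoneOp {X : Type*} [NormedAddCommGroup X] [InnerProductSpace ℝ X]
    (A : X → Set X) : Prop :=
  ∀ x y u v : X, u ∈ A x → v ∈ A y → 0 ≤ inner ℝ (u - v) (x - y)

/-- `A` is maximal monotone: monotone, and its graph is not contained in the graph of any other
monotone operator. -/
def IsMaximalMonotoneOp {X : Type*} [NormedAddCommGroup X] [InnerProductSpace ℝ X]
    (A : X → Set X) : Prop :=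
  IsMonotoneOp A ∧ ∀ A' : X → Set X, IsMonotoneOp A' → (∀ x, A x ⊆ A' x) → A' = A

/-- The resolvent `(Id + A)⁻¹` as a function: the point `u` with `x ∈ u + A u`. If `A` is maximal
monotone on a Euclidean space, there is exactly one such `u` for every `x`. (Where no such `u`
exists the value is an arbitrary point.) -/
noncomputable def opResolvent {X : Type*} [NormedAddCommGroup X] [InnerProductSpace ℝ X]
    (A : X → Set X) (x : X) : X :=
  Classical.epsilon fun u => x ∈ ({u} : Set X) + A u

/-- The Clarke Jacobian of `f` at `x`: the convex hull of all limits of derivatives of `f` along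
sequences of differentiability points converging to `x`. Jacobian matrices are represented by
the corresponding (continuous) linear maps. -/
def clarkeJacobian {E F : Type*} [NormedAddCommGroup E] [NormedSpace ℝ E]
    [NormedAddCommGroup F] [NormedSpace ℝ F] (f : E → F) (x : E) : Set (E →L[ℝ] F) :=
  convexHull ℝ {M | ∃ s : ℕ → E, (∀ k, DifferentiableAt ℝ f (s k)) ∧
    Tendsto s atTop (𝓝 x) ∧ Tendsto (fun k => fderiv ℝ f (s k)) atTop (𝓝 M)}

/-- `J` is a conservative Jacobian on the open set `U` for `f : U → F` (the values of `f` and `J`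
outside `U` play no role). -/
structure IsConservativeJacobianOn {E F : Type*} [NormedAddCommGroup E] [NormedSpace ℝ E]
    [NormedAddCommGroup F] [NormedSpace ℝ F] (U : Set E) (f : E → F)
    (J : E → Set (E →L[ℝ] F)) : Prop where
  nonempty : ∀ x ∈ U, (J x).Nonempty
  locally_bounded : ∀ x ∈ U, ∃ N ∈ 𝓝 x, Bornology.IsBounded (⋃ y ∈ N ∩ U, J y)
  /-- the graph of `J` is closed relative to `U` -/
  graph_closed : ∀ x ∈ U, ∀ M : E →L[ℝ] F,
    (x, M) ∈ closure {q : E × (E →L[ℝ] F) | q.1 ∈ U ∧ q.2 ∈ J q.1} → M ∈ J x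
  /-- the chain rule along absolutely continuous curves in `U` (such curves are differentiable
  at almost every time) -/
  chain_rule : ∀ c : ℝ → E, AbsolutelyContinuousOnInterval c 0 1 →
    (∀ t ∈ Icc (0 : ℝ) 1, c t ∈ U) →
    ∀ᵐ t ∂(volume.restrict (Icc (0 : ℝ) 1)), ∀ M ∈ J (c t),
      HasDerivAt (fun τ => f (c τ)) (M (deriv c t)) t

/-- `f` is path differentiable on the open set `U`: it is locally Lipschitz there and admits a
conservative Jacobian. -/
def PathDifferentiableOn {E F : Type*} [NormedAddCommGroup E] [NormedSpace ℝ E]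
    [NormedAddCommGroup F] [NormedSpace ℝ F] (U : Set E) (f : E → F) : Prop :=
  LocallyLipschitzOn U f ∧ ∃ J : E → Set (E →L[ℝ] F), IsConservativeJacobianOn U f J

section Inclusion

variable {P X : Type*} [NormedAddCommGroup P] [NormedSpace ℝ P]
  [NormedAddCommGroup X] [InnerProductSpace ℝ X]

/-- The block `U` of `M = [U V]`. -/
def parBlock (M : P × X →L[ℝ] X) : P →L[ℝ] X := M.comp (ContinuousLinearMap.inl ℝ P X)

/-- The block `V` of `M = [U V]`. -/
def varBlock (M : P × X →L[ℝ] X) : X →L[ℝ] X := M.comp (ContinuousLinearMap.inr ℝ P X)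

/-- `x` solves the inclusion `0 ∈ A_θ(x) + B_θ(x)`. -/
def IsSolution (A : P × X → Set X) (B : P × X → X) (θ : P) (x : X) : Prop :=
  (0 : X) ∈ A (θ, x) + {B (θ, x)}

/-- `T(θ, x)`: the resolvent of `γ A_θ` at `x`. -/
noncomputable def resolventMap (γ : ℝ) (A : P × X → Set X) (q : P × X) : X :=
  opResolvent (fun u => γ • A (q.1, u)) q.2

/-- The Clarke Jacobian of `T` at `(θ, x - γ B_θ(x))`. -/
def clarkeT (γ : ℝ) (A : P × X → Set X) (B : P × X → X) (θ : P) (x : X) :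
    Set (P × X →L[ℝ] X) :=
  clarkeJacobian (resolventMap γ A) (θ, x - γ • B (θ, x))

/-- `𝒥_{x,H}(θ, x) = {V (I - γ Z)}`, with `[U V]` in the Clarke Jacobian of `T` at
`(θ, x - γ B_θ(x))` and `[W Z]` in the Clarke Jacobian of `B` at `(θ, x)`. -/
def jacXH (γ : ℝ) (A : P × X → Set X) (B : P × X → X) (θ : P) (x : X) : Set (X →L[ℝ] X) :=
  {K | ∃ M ∈ clarkeT γ A B θ x, ∃ N ∈ clarkeJacobian B (θ, x),
    K = (varBlock M).comp (ContinuousLinearMap.id ℝ X - γ • varBlock N)}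

/-- The matrix `I - V (I - γ Z)`, for `M = [U V]` and `N = [W Z]`. -/
def solMatrix (γ : ℝ) (M N : P × X →L[ℝ] X) : X →L[ℝ] X :=
  ContinuousLinearMap.id ℝ X -
    (varBlock M).comp (ContinuousLinearMap.id ℝ X - γ • varBlock N)

/-- `{(I - V (I - γ Z))⁻¹ (U - γ V W)}`, with `[U V]` in the Clarke Jacobian of `T` at
`(θ, x - γ B_θ(x))` and `[W Z]` in the Clarke Jacobian of `B` at `(θ, x)`. -/
noncomputable def jacSol (γ : ℝ) (A : P × X → Set X) (B : P × X → X) (θ : P) (x : X) :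
    Set (P →L[ℝ] X) :=
  {G | ∃ M ∈ clarkeT γ A B θ x, ∃ N ∈ clarkeJacobian B (θ, x),
    G = (solMatrix γ M N).inverse.comp
      (parBlock M - γ • (varBlock M).comp (parBlock N))}

/-- The residual equation is contractive: for each `θ ∈ Θ` there is a solution `x` of the
inclusion with `‖𝒥_{x,H}(θ, x)‖_op < 1`, the supremum of the operator norms over the set. -/
def IsContractive (Θ : Set P) (γ : ℝ) (A : P × X → Set X) (B : P × X → X) : Prop :=
  ∀ θ ∈ Θ, ∃ x, IsSolution A B θ x ∧ (⨆ K ∈ jacXH γ A B θ x, ‖K‖ₑ) < 1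

end Inclusion

/-! Solutions of the inclusion are the fixed points of H(θ, x) = T(θ, x - γ B_θ(x)), and
differentiating x = H(θ, x) along a curve gives a linear system with matrix I - V(I - γZ). Four
facts make this rigorous.

The Clarke Jacobian of a path differentiable map is itself conservative
(`PathDifferentiableOn.isConservativeJacobianOn_clarkeJacobian`). At almost every time all elements
of a given conservative Jacobian agree on the velocity. Upper hemicontinuity and a mean value
inequality on short segments force every limit of derivatives to agree with them there.

The set of products V(I - γZ) is upper hemicontinuous, so a bound k < 1 at one solution persists
nearby. Integrating along segments with θ frozen makes H(θ, ·) a k-contraction on a ball, uniformly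
in θ (`exists_ball_forwardBackward_contracting`).

That contraction isolates the solution. By monotonicity, a second solution would make all points of
the joining segment near the first one solutions too, so uniqueness is global
(`IsMaximalMonotoneOp.zero_unique_of_isolated`). Resolvents are total and nonexpansive by Minty's
theorem, proved here from a minimax theorem and compactness.

Banach's fixed point theorem then makes the solution map locally Lipschitz. It preserves absolute
continuity of curves, the linear system can be solved for its velocity, and continuity of inversion
carries compactness and upper hemicontinuity to the solved Jacobian
(`isConservativeJacobianOn_jacSol`). -/

/-! ### Convex hulls of compact sets and upper hemicontinuity -/

/-- In a finite-dimensional space the convex hull of a compact set is compact. -/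
theorem IsCompact.convexHull_of_finiteDimensional {E : Type*} [NormedAddCommGroup E]
    [NormedSpace ℝ E] [FiniteDimensional ℝ E] {s : Set E} (hs : IsCompact s) :
    IsCompact (convexHull ℝ s) := by
  classical
  -- Joining `s` by segments to the compact set of the previous stage captures the hulls of one more
  -- point; Carathéodory's theorem makes finitely many stages enough.
  have key : ∀ m : ℕ, ∃ K : Set E, IsCompact K ∧ K ⊆ convexHull ℝ s ∧
      ∀ t : Finset E, (t : Set E) ⊆ s → t.card ≤ m + 1 → convexHull ℝ (t : Set E) ⊆ K := by
    intro m
    induction m with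
    | zero =>
      refine ⟨s, hs, subset_convexHull ℝ s, fun t hts hc => ?_⟩
      rcases Nat.le_one_iff_eq_zero_or_eq_one.1 (by simpa using hc) with h | h
      · simp [Finset.card_eq_zero.1 h]
      · obtain ⟨a, rfl⟩ := Finset.card_eq_one.1 h
        simpa using hts
    | succ m ih =>
      obtain ⟨K, hK, hKs, hKt⟩ := ih
      refine ⟨(fun q : ℝ × E × E => (1 - q.1) • q.2.1 + q.1 • q.2.2) '' (Icc 0 1 ×ˢ s ×ˢ K),
        (isCompact_Icc.prod (hs.prod hK)).image (by fun_prop), ?_, fun t hts hc => ?_⟩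
      · rintro _ ⟨⟨r, a, b⟩, ⟨hr, ha, hb⟩, rfl⟩
        exact (convex_convexHull ℝ s) (subset_convexHull ℝ s ha) (hKs hb)
          (sub_nonneg.2 hr.2) hr.1 (by simp)
      · rcases t.eq_empty_or_nonempty with rfl | ⟨a, ha⟩
        · simp
        have has : a ∈ s := hts ha
        rw [← Finset.insert_erase ha, Finset.coe_insert]
        have hcard : (t.erase a).card ≤ m + 1 := by
          rw [Finset.card_erase_of_mem ha]; omega
        rcases (t.erase a).eq_empty_or_nonempty with h0 | h0
        · have haK : a ∈ K := hKt {a} (by simpa using has) (by simp) (by simp)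
          rw [h0]
          intro y hy
          have hy' : y = a := by simpa using hy
          exact ⟨(0, a, a), ⟨by simp, has, haK⟩, by simp [hy']⟩
        · rw [convexHull_insert (by exact_mod_cast h0)]
          intro y hy
          obtain ⟨a', ha', b, hb, hyab⟩ := mem_convexJoin.1 hy
          rw [mem_singleton_iff] at ha'
          subst ha'
          rw [segment_eq_image] at hyab
          obtain ⟨r, hr, rfl⟩ := hyab
          exact ⟨(r, a', b), ⟨hr, has, hKt _ ((Finset.coe_subset.2 (Finset.erase_subset _ _)).trans
            hts) hcard hb⟩, rfl⟩
  obtain ⟨K, hK, hKs, hKt⟩ := key (Module.finrank ℝ E)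
  have : convexHull ℝ s = K := by
    refine Subset.antisymm ?_ hKs
    rw [convexHull_eq_union]
    refine iUnion₂_subset fun t hts => iUnion_subset fun hti => hKt t hts ?_
    simpa using hti.card_le_finrank_succ.trans
      (Nat.succ_le_succ (Submodule.finrank_le _))
  rwa [this]

/-- A thickening of a convex set is convex, so once it contains nearby values it contains their
hulls. Compactness of the hull at `x` fits a thickening inside any open set containing it. -/
theorem UpperHemicontinuousAt.convexHull {α E : Type*} [TopologicalSpace α]
    [NormedAddCommGroup E] [NormedSpace ℝ E] [FiniteDimensional ℝ E] {S : α → Set E} {x : α}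
    (hS : UpperHemicontinuousAt S x) (hc : IsCompact (S x)) :
    UpperHemicontinuousAt (fun y => _root_.convexHull ℝ (S y)) x := by
  refine .of_forall_isOpen fun t ht hxt => ?_
  obtain ⟨δ, hδ, hδt⟩ := hc.convexHull_of_finiteDimensional.exists_thickening_subset_open ht hxt
  have hcv : Convex ℝ (Metric.thickening δ (_root_.convexHull ℝ (S x))) :=
    (convex_convexHull ℝ _).thickening δ
  filter_upwards [hS.forall_isOpen _ Metric.isOpen_thickening
    ((subset_convexHull ℝ (S x)).trans (Metric.self_subset_thickening hδ _))] with y hy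
  exact (convexHull_min hy hcv).trans hδt

theorem UpperHemicontinuousAt.image_of_continuousAt {α β γ : Type*} [TopologicalSpace α]
    [TopologicalSpace β] [TopologicalSpace γ] {S : α → Set β} {x : α} {Φ : β → γ}
    (hS : UpperHemicontinuousAt S x) (hΦ : ∀ p ∈ S x, ContinuousAt Φ p) :
    UpperHemicontinuousAt (fun y => Φ '' S y) x := by
  refine .of_forall_isOpen fun t ht hxt => ?_
  have : Φ ⁻¹' t ∈ 𝓝ˢ (S x) := by
    rw [mem_nhdsSet_iff_forall]
    exact fun p hp => (hΦ p hp).preimage_mem_nhds (ht.mem_nhds (hxt (mem_image_of_mem Φ hp)))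
  filter_upwards [upperHemicontinuousAt_iff.1 hS _ this] with y hy
  exact image_subset_iff.2 (subset_of_mem_nhdsSet hy)

/-- The tube lemma: for compact factors, neighbourhoods of the product contain products of
neighbourhoods. -/
theorem UpperHemicontinuousAt.prod_of_isCompact {α β γ : Type*} [TopologicalSpace α]
    [TopologicalSpace β] [TopologicalSpace γ] {S : α → Set β} {R : α → Set γ} {x : α}
    (hS : UpperHemicontinuousAt S x) (hR : UpperHemicontinuousAt R x)
    (hSc : IsCompact (S x)) (hRc : IsCompact (R x)) :
    UpperHemicontinuousAt (fun y => S y ×ˢ R y) x := by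
  rw [upperHemicontinuousAt_iff] at *
  intro t ht
  rw [hSc.nhdsSet_prod_eq hRc] at ht
  obtain ⟨u, hu, v, hv, huv⟩ := Filter.mem_prod_iff.1 ht
  filter_upwards [hS u hu, hR v hv] with y hyu hyv
  exact Filter.mem_of_superset (nhdsSet_prod_le _ _ (prod_mem_prod hyu hyv)) huv

theorem UpperHemicontinuousAt.comp_continuousAt {α β γ : Type*} [TopologicalSpace α]
    [TopologicalSpace β] [TopologicalSpace γ] {S : β → Set γ} {g : α → β} {x : α}
    (hS : UpperHemicontinuousAt S (g x)) (hg : ContinuousAt g x) :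
    UpperHemicontinuousAt (fun y => S (g y)) x :=
  fun t ht => hg.eventually (hS t ht)

theorem UpperHemicontinuousAt.locally_bounded {α E : Type*} [TopologicalSpace α]
    [NormedAddCommGroup E] {S : α → Set E} {x : α}
    (hS : UpperHemicontinuousAt S x) (hc : IsCompact (S x)) :
    ∃ N ∈ 𝓝 x, Bornology.IsBounded (⋃ y ∈ N, S y) := by
  refine ⟨_, hS.forall_isOpen _ Metric.isOpen_thickening
    (Metric.self_subset_thickening one_pos (S x)), ?_⟩
  exact hc.isBounded.thickening.subset (iUnion₂_subset fun y hy => hy)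

/-! ### Conservative, limiting and Clarke Jacobians as upper hemicontinuous maps -/

section Jacobians

variable {E F : Type*} [NormedAddCommGroup E] [NormedSpace ℝ E]
  [NormedAddCommGroup F] [NormedSpace ℝ F]

/-- A family of nonempty compact sets that is upper hemicontinuous on `U` and satisfies the chain
rule along curves is a conservative Jacobian. -/
theorem IsConservativeJacobianOn.of_upperHemicontinuousAt {U : Set E} {f : E → F}
    {J : E → Set (E →L[ℝ] F)} (hne : ∀ x ∈ U, (J x).Nonempty) (hc : ∀ x ∈ U, IsCompact (J x))
    (hJ : ∀ x ∈ U, UpperHemicontinuousAt J x)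
    (hchain : ∀ c : ℝ → E, AbsolutelyContinuousOnInterval c 0 1 →
      (∀ t ∈ Icc (0 : ℝ) 1, c t ∈ U) →
      ∀ᵐ t ∂(volume.restrict (Icc (0 : ℝ) 1)), ∀ M ∈ J (c t),
        HasDerivAt (fun τ => f (c τ)) (M (deriv c t)) t) :
    IsConservativeJacobianOn U f J where
  nonempty := hne
  locally_bounded x hx := by
    obtain ⟨N, hN, hb⟩ := (hJ x hx).locally_bounded (hc x hx)
    exact ⟨N, hN, hb.subset (biUnion_mono inter_subset_left fun _ _ => Subset.rfl)⟩
  graph_closed x hx M hM := by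
    obtain ⟨q, hq, hqt⟩ := mem_closure_iff_seq_limit.1 hM
    rw [nhds_prod_eq] at hqt
    exact (hJ x hx).mem_of_tendsto (hc x hx).isClosed (tendsto_fst.comp hqt)
      (Frequently.of_forall fun n => (hq n).2) (tendsto_snd.comp hqt)
  chain_rule := hchain

/-- Local boundedness puts nearby values in one compact set, where a closed graph is enough for
upper hemicontinuity. -/
theorem IsConservativeJacobianOn.upperHemicontinuousAt [FiniteDimensional ℝ E]
    [FiniteDimensional ℝ F] {U : Set E} {f : E → F} {J : E → Set (E →L[ℝ] F)}
    (hJ : IsConservativeJacobianOn U f J) (hU : IsOpen U) {x : E} (hx : x ∈ U) :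
    UpperHemicontinuousAt J x := by
  obtain ⟨N, hN, hb⟩ := hJ.locally_bounded x hx
  refine .of_sequences hb.isCompact_closure.isSeqCompact ?_ ?_
  · filter_upwards [hN, hU.mem_nhds hx] with y hy hyU
    exact (subset_biUnion_of_mem (u := J) (⟨hy, hyU⟩ : y ∈ N ∩ U)).trans subset_closure
  · intro y hy M hM M₀ hM₀
    refine hJ.graph_closed x hx M₀ (mem_closure_of_tendsto (hy.prodMk_nhds hM₀) ?_)
    filter_upwards [hy.eventually (hU.mem_nhds hx)] with n hn
    exact ⟨hn, hM n⟩

/-- The limits of derivatives of `f` along sequences of differentiability points tending to `x`;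
the Clarke Jacobian is its convex hull. -/
def limitingJacobian (f : E → F) (x : E) : Set (E →L[ℝ] F) :=
  {M | ∃ s : ℕ → E, (∀ k, DifferentiableAt ℝ f (s k)) ∧
    Tendsto s atTop (𝓝 x) ∧ Tendsto (fun k => fderiv ℝ f (s k)) atTop (𝓝 M)}

/-- As a section of the closure of the graph of the derivative, the limiting Jacobian inherits
closedness, and its own graph is closed. -/
theorem mem_limitingJacobian_iff {f : E → F} {x : E} {M : E →L[ℝ] F} :
    M ∈ limitingJacobian f x ↔
      (x, M) ∈ closure {q : E × (E →L[ℝ] F) | DifferentiableAt ℝ f q.1 ∧ q.2 = fderiv ℝ f q.1} := by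
  rw [mem_closure_iff_seq_limit]
  constructor
  · rintro ⟨s, hs, hsx, hsM⟩
    exact ⟨fun k => (s k, fderiv ℝ f (s k)), fun k => ⟨hs k, rfl⟩, hsx.prodMk_nhds hsM⟩
  · rintro ⟨q, hq, hqt⟩
    rw [nhds_prod_eq] at hqt
    refine ⟨fun k => (q k).1, fun k => (hq k).1, tendsto_fst.comp hqt, ?_⟩
    simpa only [← (hq _).2, Function.comp_def] using tendsto_snd.comp hqt

theorem isClosed_limitingJacobian (f : E → F) (x : E) : IsClosed (limitingJacobian f x) := by
  have : limitingJacobian f x = (fun M : E →L[ℝ] F => (x, M)) ⁻¹'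
      closure {q : E × (E →L[ℝ] F) | DifferentiableAt ℝ f q.1 ∧ q.2 = fderiv ℝ f q.1} :=
    Set.ext fun M => mem_limitingJacobian_iff
  rw [this]
  exact isClosed_closure.preimage (by fun_prop)

theorem limitingJacobian_subset_closedBall {f : E → F} {t : Set E} {K : NNReal}
    (hf : LipschitzOnWith K f t) {x : E} (ht : t ∈ 𝓝 x) :
    limitingJacobian f x ⊆ Metric.closedBall 0 K := by
  rintro M ⟨s, -, hsx, hsM⟩
  rw [mem_closedBall_zero_iff]
  refine le_of_tendsto hsM.norm ?_
  filter_upwards [hsx.eventually (eventually_mem_nhds_iff.2 ht)] with k hk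
  exact norm_fderiv_le_of_lipschitzOn ℝ hk hf

variable [FiniteDimensional ℝ E]

/-- By Rademacher's theorem differentiability points accumulate at `x`; derivatives there are
bounded by `K`, so a subsequence converges. -/
theorem limitingJacobian_nonempty [FiniteDimensional ℝ F] {f : E → F} {t : Set E} {K : NNReal}
    (hf : LipschitzOnWith K f t) {x : E} (ht : t ∈ 𝓝 x) : (limitingJacobian f x).Nonempty := by
  let _ : MeasurableSpace E := borel E
  have : BorelSpace E := ⟨rfl⟩
  have hd := hf.ae_differentiableWithinAt_of_mem (μ := (Measure.addHaar : Measure E))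
  have hx : x ∈ closure {y | y ∈ interior t ∧ DifferentiableAt ℝ f y} := by
    rw [mem_closure_iff_nhds]
    intro V hV
    have hpos : 0 < (Measure.addHaar : Measure E) (V ∩ interior t) :=
      Measure.measure_pos_of_mem_nhds _ (inter_mem hV (interior_mem_nhds.2 ht))
    obtain ⟨y, ⟨hyV, hyt⟩, hy⟩ := (frequently_ae_mem_iff.2 hpos.ne').and_eventually hd |>.exists
    exact ⟨y, hyV, hyt, (hy (interior_subset hyt)).differentiableAt
      (mem_interior_iff_mem_nhds.1 hyt)⟩
  obtain ⟨s, hs, hsx⟩ := mem_closure_iff_seq_limit.1 hx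
  obtain ⟨M, -, φ, hφ, hM⟩ := (isCompact_closedBall (0 : E →L[ℝ] F) (K : ℝ)).tendsto_subseq
    (x := fun k => fderiv ℝ f (s k)) fun k => by
      rw [mem_closedBall_zero_iff]
      exact norm_fderiv_le_of_lipschitzOn ℝ (mem_interior_iff_mem_nhds.1 (hs k).1) hf
  exact ⟨M, s ∘ φ, fun k => (hs _).2, hsx.comp hφ.tendsto_atTop, hM⟩

variable [FiniteDimensional ℝ F] {U : Set E} {f : E → F} {x : E}

theorem LocallyLipschitzOn.exists_lipschitzOnWith_nhds {X Y : Type*} [PseudoEMetricSpace X]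
    [PseudoEMetricSpace Y] {V : Set X} {g : X → Y} (hg : LocallyLipschitzOn V g)
    (hV : IsOpen V) {a : X} (ha : a ∈ V) : ∃ K, ∃ t ∈ 𝓝 a, LipschitzOnWith K g t := by
  obtain ⟨K, t, ht, h⟩ := hg ha
  exact ⟨K, t, by rwa [hV.nhdsWithin_eq ha] at ht, h⟩

theorem isCompact_limitingJacobian (hf : LocallyLipschitzOn U f) (hU : IsOpen U) (hx : x ∈ U) :
    IsCompact (limitingJacobian f x) := by
  obtain ⟨K, t, ht, h⟩ := hf.exists_lipschitzOnWith_nhds hU hx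
  exact (isCompact_closedBall _ _).of_isClosed_subset (isClosed_limitingJacobian f x)
    (limitingJacobian_subset_closedBall h ht)

theorem upperHemicontinuousAt_limitingJacobian (hf : LocallyLipschitzOn U f) (hU : IsOpen U)
    (hx : x ∈ U) : UpperHemicontinuousAt (limitingJacobian f) x := by
  obtain ⟨K, t, ht, h⟩ := hf.exists_lipschitzOnWith_nhds hU hx
  refine .of_sequences (isCompact_closedBall (0 : E →L[ℝ] F) (K : ℝ)).isSeqCompact ?_ ?_
  · filter_upwards [eventually_mem_nhds_iff.2 ht] with y hy
    exact limitingJacobian_subset_closedBall h hy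
  · intro y hy M hM M₀ hM₀
    rw [mem_limitingJacobian_iff]
    exact isClosed_closure.mem_of_tendsto (hy.prodMk_nhds hM₀)
      (Eventually.of_forall fun n => mem_limitingJacobian_iff.1 (hM n))

theorem isCompact_clarkeJacobian (hf : LocallyLipschitzOn U f) (hU : IsOpen U) (hx : x ∈ U) :
    IsCompact (clarkeJacobian f x) :=
  (isCompact_limitingJacobian hf hU hx).convexHull_of_finiteDimensional

theorem upperHemicontinuousAt_clarkeJacobian (hf : LocallyLipschitzOn U f) (hU : IsOpen U)
    (hx : x ∈ U) : UpperHemicontinuousAt (clarkeJacobian f) x :=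
  (upperHemicontinuousAt_limitingJacobian hf hU hx).convexHull (isCompact_limitingJacobian hf hU hx)

theorem clarkeJacobian_nonempty (hf : LocallyLipschitzOn U f) (hU : IsOpen U) (hx : x ∈ U) :
    (clarkeJacobian f x).Nonempty := by
  obtain ⟨K, t, ht, h⟩ := hf.exists_lipschitzOnWith_nhds hU hx
  exact (limitingJacobian_nonempty h ht).mono (subset_convexHull ℝ _)

end Jacobians

/-! ### Absolutely continuous curves -/

section Curves

theorem LipschitzOnWith.comp_absolutelyContinuousOnInterval {X Y : Type*} [PseudoMetricSpace X]
    [PseudoMetricSpace Y] {K : NNReal} {f : X → Y} {c : ℝ → X} {a b : ℝ}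
    (hf : LipschitzOnWith K f (c '' uIcc a b)) (hc : AbsolutelyContinuousOnInterval c a b) :
    AbsolutelyContinuousOnInterval (fun t => f (c t)) a b := by
  unfold AbsolutelyContinuousOnInterval at *
  refine squeeze_zero' (Eventually.of_forall fun E => Finset.sum_nonneg fun _ _ => dist_nonneg)
    ?_ (by simpa using hc.const_mul (K : ℝ))
  filter_upwards [mem_inf_of_right (mem_principal_self _)] with E hE
  rw [Finset.mul_sum]
  exact Finset.sum_le_sum fun i hi => hf.dist_le_mul _ (mem_image_of_mem c (hE.1 i hi).1) _
    (mem_image_of_mem c (hE.1 i hi).2)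

theorem LocallyLipschitzOn.comp_absolutelyContinuousOnInterval {X Y : Type*} [NormedAddCommGroup X]
    [PseudoMetricSpace Y] {U : Set X} {f : X → Y} {c : ℝ → X} {a b : ℝ}
    (hf : LocallyLipschitzOn U f) (hc : AbsolutelyContinuousOnInterval c a b)
    (hcU : ∀ t ∈ uIcc a b, c t ∈ U) :
    AbsolutelyContinuousOnInterval (fun t => f (c t)) a b := by
  have himg : c '' uIcc a b ⊆ U := image_subset_iff.2 hcU
  have hcomp : IsCompact (c '' uIcc a b) := isCompact_uIcc.image_of_continuousOn hc.continuousOn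
  obtain ⟨K, hK⟩ := LocallyLipschitzOn.exists_lipschitzOnWith_of_compact hcomp (hf.mono himg)
  exact hK.comp_absolutelyContinuousOnInterval hc

theorem AbsolutelyContinuousOnInterval.prodMk {X Y : Type*} [PseudoMetricSpace X]
    [PseudoMetricSpace Y] {c : ℝ → X} {d : ℝ → Y} {a b : ℝ}
    (hc : AbsolutelyContinuousOnInterval c a b) (hd : AbsolutelyContinuousOnInterval d a b) :
    AbsolutelyContinuousOnInterval (fun t => (c t, d t)) a b := by
  unfold AbsolutelyContinuousOnInterval at *
  refine squeeze_zero (fun E => Finset.sum_nonneg fun _ _ => dist_nonneg) (fun E => ?_)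
    (by simpa using hc.add hd)
  rw [← Finset.sum_add_distrib]
  refine Finset.sum_le_sum fun i _ => ?_
  rw [Prod.dist_eq]
  exact max_le_add_of_nonneg dist_nonneg dist_nonneg

theorem AbsolutelyContinuousOnInterval.ae_differentiableAt_of_finiteDimensional {F : Type*}
    [NormedAddCommGroup F] [NormedSpace ℝ F] [FiniteDimensional ℝ F] {c : ℝ → F}
    (hc : AbsolutelyContinuousOnInterval c 0 1) :
    ∀ᵐ t ∂(volume.restrict (Icc (0 : ℝ) 1)), DifferentiableAt ℝ c t := by
  rw [ae_restrict_iff' measurableSet_Icc, ← uIcc_of_le (zero_le_one (α := ℝ))]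
  exact hc.boundedVariationOn.ae_differentiableAt_of_mem_uIcc

theorem absolutelyContinuousOnInterval_add_smul {F : Type*} [NormedAddCommGroup F]
    [NormedSpace ℝ F] (y w : F) (a b : ℝ) :
    AbsolutelyContinuousOnInterval (fun t : ℝ => y + t • w) a b :=
  ContDiffOn.absolutelyContinuousOnInterval (by fun_prop)

/-- Mean value inequality for absolutely continuous curves. -/
theorem AbsolutelyContinuousOnInterval.norm_sub_le {F : Type*} [NormedAddCommGroup F]
    [NormedSpace ℝ F] {g : ℝ → F} {C : ℝ} (hg : AbsolutelyContinuousOnInterval g 0 1)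
    (h : ∀ᵐ t ∂(volume.restrict (Icc (0 : ℝ) 1)), ∃ g', HasDerivAt g g' t ∧ ‖g'‖ ≤ C) :
    ‖g 1 - g 0‖ ≤ C := by
  -- A norming functional reduces the estimate to the scalar fundamental theorem of calculus.
  obtain ⟨φ, hφ, hφg⟩ := exists_dual_vector'' ℝ (g 1 - g 0)
  have hac : AbsolutelyContinuousOnInterval (fun t => φ (g t)) 0 1 :=
    (φ.lipschitz.lipschitzOnWith (s := _)).comp_absolutelyContinuousOnInterval hg
  have hint := hac.integral_deriv_eq_sub
  rw [← map_sub, hφg] at hint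
  rw [ae_restrict_iff' measurableSet_Icc] at h
  have hb := intervalIntegral.norm_integral_le_of_norm_le_const_ae (a := 0) (b := 1)
    (f := deriv fun t => φ (g t)) (C := C) (by
      filter_upwards [h] with t ht hmem
      rw [uIoc_of_le zero_le_one] at hmem
      obtain ⟨g', hg', hC⟩ := ht (Ioc_subset_Icc_self hmem)
      have : HasDerivAt (fun t => φ (g t)) (φ g') t := φ.hasFDerivAt.comp_hasDerivAt t hg'
      rw [this.deriv]
      exact (φ.le_of_opNorm_le hφ g').trans (by simpa using hC))
  rw [hint] at hb
  simpa using hb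

end Curves

/-! ### The Clarke Jacobian of a path differentiable map is conservative -/

section Clarke

variable {E F : Type*} [NormedAddCommGroup E] [NormedSpace ℝ E]
  [NormedAddCommGroup F] [NormedSpace ℝ F] {U : Set E} {f : E → F} {J : E → Set (E →L[ℝ] F)}

/-- The mean value inequality for `t ↦ f (y + t • w) - t • z`, whose derivative is `N w - z` at
almost every time. -/
theorem IsConservativeJacobianOn.norm_sub_sub_le (hJ : IsConservativeJacobianOn U f J)
    (hf : LocallyLipschitzOn U f) {y w : E} {z : F} {C : ℝ}
    (hU : ∀ t ∈ Icc (0 : ℝ) 1, y + t • w ∈ U)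
    (hC : ∀ t ∈ Icc (0 : ℝ) 1, ∀ N ∈ J (y + t • w), ‖N w - z‖ ≤ C) :
    ‖f (y + w) - f y - z‖ ≤ C := by
  have hc := absolutelyContinuousOnInterval_add_smul y w 0 1
  have hfc : AbsolutelyContinuousOnInterval (fun t : ℝ => f (y + t • w)) 0 1 :=
    hf.comp_absolutelyContinuousOnInterval hc (by rwa [uIcc_of_le zero_le_one])
  have hz := absolutelyContinuousOnInterval_add_smul (0 : F) z 0 1
  have := (hfc.sub hz).norm_sub_le (C := C) (by
    filter_upwards [hJ.chain_rule _ hc hU, ae_restrict_mem measurableSet_Icc] with t ht htI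
    obtain ⟨N, hN⟩ := hJ.nonempty _ (hU t htI)
    have hcd : HasDerivAt (fun t : ℝ => y + t • w) w t := by
      simpa using ((hasDerivAt_id t).smul_const w).const_add y
    have hzd : HasDerivAt (fun t : ℝ => 0 + t • z) z t := by
      simpa using ((hasDerivAt_id t).smul_const z).const_add 0
    have h1 := ht N hN
    rw [hcd.deriv] at h1
    exact ⟨_, h1.sub hzd, hC t htI N hN⟩)
  have e : f (y + w) - f y - z =
      ((fun t : ℝ => f (y + t • w)) - fun t : ℝ => 0 + t • z) 1 -
      ((fun t : ℝ => f (y + t • w)) - fun t : ℝ => 0 + t • z) 0 := by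
    simp only [Pi.sub_apply, one_smul, zero_smul, add_zero, zero_add, sub_zero]
    abel
  rw [e]
  exact this

variable [FiniteDimensional ℝ E] [FiniteDimensional ℝ F]

/-- If a conservative Jacobian is single-valued at `x` in the direction `v`, then every limit of
derivatives at `x` takes the same value in this direction. -/
theorem IsConservativeJacobianOn.limitingJacobian_apply_eq (hJ : IsConservativeJacobianOn U f J)
    (hf : LocallyLipschitzOn U f) (hU : IsOpen U) {x v : E} {z : F} (hx : x ∈ U)
    (hz : ∀ N ∈ J x, N v = z) {M : E →L[ℝ] F} (hM : M ∈ limitingJacobian f x) : M v = z := by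
  obtain ⟨s, hs, hsx, hsM⟩ := hM
  rw [← sub_eq_zero, ← norm_le_zero_iff]
  refine le_of_forall_pos_le_add fun ε hε => ?_
  rw [zero_add]
  have hopen : IsOpen {N : E →L[ℝ] F | ‖N v - z‖ < ε} :=
    isOpen_lt (by fun_prop) continuous_const
  have hev := (hJ.upperHemicontinuousAt hU hx).forall_isOpen _ hopen
    (fun N hN => by simp [hz N hN, hε])
  obtain ⟨r, hr, hball⟩ := Metric.eventually_nhds_iff_ball.1 (hev.and (hU.mem_nhds hx))
  have hlim : Tendsto (fun k => ‖fderiv ℝ f (s k) v - z‖) atTop (𝓝 ‖M v - z‖) :=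
    ((((ContinuousLinearMap.apply ℝ F v).continuous.tendsto M).comp hsM).sub_const z).norm
  refine le_of_tendsto hlim ?_
  filter_upwards [hsx.eventually (Metric.ball_mem_nhds x hr)] with k hk
  have hline : HasDerivAt (fun t : ℝ => f (s k + t • v)) (fderiv ℝ f (s k) v) 0 :=
    (hs k).hasFDerivAt.hasLineDerivAt v
  have hslope := hline.tendsto_slope_zero_right
  refine le_of_tendsto (hslope.sub_const z).norm ?_
  have hcont : Tendsto (fun t : ℝ => s k + t • v) (𝓝[>] 0) (𝓝 (s k)) := by
    have : Continuous fun t : ℝ => s k + t • v := by fun_prop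
    simpa using (this.tendsto 0).mono_left nhdsWithin_le_nhds
  filter_upwards [hcont.eventually (Metric.isOpen_ball.mem_nhds hk), self_mem_nhdsWithin]
    with t ht htpos
  have htpos : 0 < t := htpos
  have hseg : ∀ τ ∈ Icc (0 : ℝ) 1, s k + τ • t • v ∈ Metric.ball x r := fun τ hτ =>
    (convex_ball x r).add_smul_mem hk ht hτ
  -- On the short segment from `s k` every `N` satisfies `‖N v - z‖ < ε`, so the difference quotient
  -- of `f` at `s k` in direction `v` is within `ε` of `z`.
  have hmv := hJ.norm_sub_sub_le hf (z := t • z) (C := t * ε)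
    (fun τ hτ => (hball _ (hseg τ hτ)).2) fun τ hτ N hN => by
      have hN' : ‖N v - z‖ < ε := (hball _ (hseg τ hτ)).1 hN
      rw [map_smul, ← smul_sub, norm_smul, Real.norm_of_nonneg htpos.le]
      gcongr
  have e : t⁻¹ • (f (s k + (0 + t) • v) - f (s k + (0 : ℝ) • v)) - z =
      t⁻¹ • (f (s k + t • v) - f (s k) - t • z) := by
    rw [zero_add, zero_smul, add_zero, smul_sub _ _ (t • z), inv_smul_smul₀ htpos.ne']
  rw [e, norm_smul, norm_inv, Real.norm_of_nonneg htpos.le]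
  calc t⁻¹ * ‖f (s k + t • v) - f (s k) - t • z‖ ≤ t⁻¹ * (t * ε) := by gcongr
    _ = ε := by field_simp

theorem IsConservativeJacobianOn.clarkeJacobian_apply_eq (hJ : IsConservativeJacobianOn U f J)
    (hf : LocallyLipschitzOn U f) (hU : IsOpen U) {x v : E} {z : F} (hx : x ∈ U)
    (hz : ∀ N ∈ J x, N v = z) {M : E →L[ℝ] F} (hM : M ∈ clarkeJacobian f x) : M v = z := by
  have hcv : Convex ℝ {M : E →L[ℝ] F | M v = z} :=
    (convex_singleton z).linear_preimage (ContinuousLinearMap.apply ℝ F v).toLinearMap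
  exact convexHull_min (fun M hM => hJ.limitingJacobian_apply_eq hf hU hx hz hM) hcv hM

/-- Uniqueness of derivatives makes `J` single-valued in the direction of the velocity at almost
every time; `clarkeJacobian_apply_eq` passes this value to the Clarke Jacobian. -/
theorem PathDifferentiableOn.isConservativeJacobianOn_clarkeJacobian
    (hf : PathDifferentiableOn U f) (hU : IsOpen U) :
    IsConservativeJacobianOn U f (clarkeJacobian f) := by
  obtain ⟨hlip, J, hJ⟩ := hf
  refine .of_upperHemicontinuousAt (fun x hx => clarkeJacobian_nonempty hlip hU hx)
    (fun x hx => isCompact_clarkeJacobian hlip hU hx)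
    (fun x hx => upperHemicontinuousAt_clarkeJacobian hlip hU hx) fun c hc hcU => ?_
  filter_upwards [hJ.chain_rule c hc hcU, ae_restrict_mem measurableSet_Icc] with t ht htI M hM
  obtain ⟨N, hN⟩ := hJ.nonempty _ (hcU t htI)
  rw [hJ.clarkeJacobian_apply_eq hlip hU (hcU t htI)
    (fun N' hN' => (ht N' hN').unique (ht N hN)) hM]
  exact ht N hN

end Clarke

/-! ### Resolvents of maximal monotone operators -/

section Monotone

variable {X : Type*} [NormedAddCommGroup X] [InnerProductSpace ℝ X]

/-- The finite case of Minty's theorem, from the minimax theorem. -/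
theorem exists_inner_add_nonneg_of_monotone_finite {ι : Type*} [Fintype ι] [Nonempty ι]
    (v a : ι → X) (hmono : ∀ i j, 0 ≤ inner ℝ (a i - a j) (v i - v j)) :
    ∃ u, ∀ i, 0 ≤ inner ℝ (a i + u) (v i - u) := by
  classical
  -- Convex in `u` and linear in `μ`, so a saddle point exists. Evaluating at a vertex of the
  -- simplex isolates one of the required inequalities.
  let f : X → (ι → ℝ) → ℝ := fun u μ => ∑ i, μ i * inner ℝ (a i + u) (u - v i)
  have hcont : Continuous fun q : X × (ι → ℝ) => f q.1 q.2 := by fun_prop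
  obtain ⟨u, hu, μ, hμ, hsad⟩ := Sion.exists_isSaddlePointOn (f := f)
    (X := convexHull ℝ (range v)) (Y := stdSimplex ℝ ι)
    ((range_nonempty v).convexHull) (convex_convexHull ℝ _)
    ((finite_range v).isCompact_convexHull ℝ)
    (fun μ _ => (hcont.comp
      (by fun_prop : Continuous fun u => (u, μ))).lowerSemicontinuous.lowerSemicontinuousOn _)
    (fun μ hμ => by
      refine ConvexOn.quasiconvexOn ⟨convex_convexHull ℝ _, fun x _ y _ s t hs ht hst => ?_⟩
      simp only [f, smul_eq_mul, Finset.mul_sum, ← Finset.sum_add_distrib]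
      refine Finset.sum_le_sum fun i _ => ?_
      have key : inner ℝ (a i + (s • x + t • y)) (s • x + t • y - v i) =
          s * inner ℝ (a i + x) (x - v i) + t * inner ℝ (a i + y) (y - v i)
            - s * t * inner ℝ (x - y) (x - y) := by
        obtain rfl : t = 1 - s := by linarith
        simp only [inner_add_left, inner_add_right, inner_sub_left, inner_sub_right,
          inner_smul_left, inner_smul_right, RCLike.conj_to_real]
        rw [real_inner_comm x y]
        ring
      rw [key]
      have h0 : 0 ≤ μ i * (s * t * inner ℝ (x - y) (x - y)) :=
        mul_nonneg (hμ.1 i) (mul_nonneg (mul_nonneg hs ht) real_inner_self_nonneg)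
      linarith)
    (convex_stdSimplex ℝ ι) ⟨_, single_mem_stdSimplex ℝ (Classical.arbitrary ι)⟩
    (isCompact_stdSimplex ℝ ι)
    (fun u _ => (hcont.comp
      (by fun_prop : Continuous fun μ => (u, μ))).upperSemicontinuous.upperSemicontinuousOn _)
    (fun u _ => by
      refine ConcaveOn.quasiconcaveOn ⟨convex_stdSimplex ℝ ι, fun x _ y _ s t _ _ _ => ?_⟩
      simp only [f, smul_eq_mul, Finset.mul_sum, ← Finset.sum_add_distrib]
      refine Finset.sum_le_sum fun i _ => ?_
      simp only [Pi.add_apply, Pi.smul_apply, smul_eq_mul]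
      apply le_of_eq
      ring)
  set w : X := ∑ i, μ i • v i with hw
  have hwmem : w ∈ convexHull ℝ (range v) :=
    (convex_convexHull ℝ _).sum_mem (fun i _ => hμ.1 i) hμ.2
      fun i _ => subset_convexHull ℝ _ (mem_range_self i)
  have hwv : ∀ b : X, ∑ j, μ j * inner ℝ b (v j) = inner ℝ b w := fun b => by
    simp [hw, inner_sum, inner_smul_right]
  have hfw : f w μ ≤ 0 := by
    have h1 : f w μ = ∑ i, μ i * inner ℝ (a i) (w - v i) := by
      have h2 : ∑ i, μ i * inner ℝ w (w - v i) = 0 := by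
        simp only [inner_sub_right, mul_sub, Finset.sum_sub_distrib, ← Finset.sum_mul, hμ.2, hwv]
        ring
      simp only [f, inner_add_left, mul_add, Finset.sum_add_distrib, h2, add_zero]
    have h3 : ∀ i, μ i * inner ℝ (a i) (w - v i) =
        ∑ j, μ i * μ j * inner ℝ (a i) (v j - v i) := fun i => by
      rw [inner_sub_right, ← hwv]
      simp only [inner_sub_right, mul_sub, Finset.sum_sub_distrib, Finset.mul_sum, ← Finset.sum_mul]
      simp only [mul_assoc, ← Finset.mul_sum, hμ.2, one_mul]
    -- Symmetrizing over pairs turns the value at the barycentre `w` into a nonpositive combination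
    -- of monotonicity terms.
    have h4 : 2 * f w μ = -∑ i, ∑ j, μ i * μ j * inner ℝ (a i - a j) (v i - v j) := by
      rw [two_mul]
      nth_rw 2 [h1]
      rw [h1, Finset.sum_congr rfl fun i _ => h3 i]
      nth_rw 2 [Finset.sum_comm]
      simp only [← Finset.sum_add_distrib, ← Finset.sum_neg_distrib]
      refine Finset.sum_congr rfl fun i _ => Finset.sum_congr rfl fun j _ => ?_
      simp only [inner_sub_left, inner_sub_right]
      ring
    have h5 : 0 ≤ ∑ i, ∑ j, μ i * μ j * inner ℝ (a i - a j) (v i - v j) :=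
      Finset.sum_nonneg fun i _ => Finset.sum_nonneg fun j _ =>
        mul_nonneg (mul_nonneg (hμ.1 i) (hμ.1 j)) (hmono i j)
    linarith
  refine ⟨u, fun i => ?_⟩
  have h := (hsad w hwmem _ (single_mem_stdSimplex ℝ i)).trans hfw
  have h6 : f u (Pi.single i 1) = inner ℝ (a i + u) (u - v i) := by
    simp only [f, Pi.single_apply, ite_mul, one_mul, zero_mul, Finset.sum_ite_eq',
      Finset.mem_univ, if_true]
  rw [h6] at h
  rw [← neg_sub u, inner_neg_right]
  linarith

/-- A point monotonically related to the graph of a maximal monotone operator lies in the graph. -/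
theorem IsMaximalMonotoneOp.mem_of_forall_inner_nonneg {A : X → Set X} (hA : IsMaximalMonotoneOp A)
    {x b : X} (h : ∀ v, ∀ a ∈ A v, 0 ≤ inner ℝ (a - b) (v - x)) : b ∈ A x := by
  have hmono : IsMonotoneOp fun y => A y ∪ {c | y = x ∧ c = b} := by
    rintro y z c d (hc | ⟨rfl, rfl⟩) (hd | ⟨rfl, rfl⟩)
    · exact hA.1 y z c d hc hd
    · exact h y c hc
    · rw [← neg_sub d, ← neg_sub z, inner_neg_neg]
      exact h z d hd
    · simp
  have := congrFun (hA.2 _ hmono fun y => subset_union_left) x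
  rw [← this]
  exact Or.inr ⟨rfl, rfl⟩

theorem IsMaximalMonotoneOp.smul {A : X → Set X} (hA : IsMaximalMonotoneOp A) {r : ℝ}
    (hr : 0 < r) : IsMaximalMonotoneOp fun x => r • A x := by
  have hpos : ∀ {s : ℝ} {A : X → Set X}, 0 ≤ s → IsMonotoneOp A →
      IsMonotoneOp fun x => s • A x := by
    rintro s A hs hA x y _ _ ⟨u, hu, rfl⟩ ⟨v, hv, rfl⟩
    simp only [← smul_sub, inner_smul_left, RCLike.conj_to_real]
    exact mul_nonneg hs (hA x y u v hu hv)
  refine ⟨hpos hr.le hA.1, fun A' hA' hsub => ?_⟩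
  have := hA.2 (fun x => r⁻¹ • A' x) (hpos (inv_nonneg.2 hr.le) hA') fun x u hu =>
    ⟨r • u, hsub x (smul_mem_smul_set hu), by simp [inv_smul_smul₀ hr.ne']⟩
  funext x
  have hx := congrFun this x
  rw [← hx]
  simp [smul_inv_smul₀ hr.ne']

/-- Minty's theorem in finite dimension. -/
theorem IsMaximalMonotoneOp.exists_sub_mem [FiniteDimensional ℝ X] {A : X → Set X}
    (hA : IsMaximalMonotoneOp A) (y : X) : ∃ u, y - u ∈ A u := by
  let ι := {q : X × X // q.2 ∈ A q.1}
  suffices h : ∃ u, ∀ q : ι, 0 ≤ inner ℝ (q.1.2 - (y - u)) (q.1.1 - u) by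
    obtain ⟨u, hu⟩ := h
    exact ⟨u, hA.mem_of_forall_inner_nonneg fun v a ha => hu ⟨(v, a), ha⟩⟩
  rcases isEmpty_or_nonempty ι with hι | ⟨⟨q₀⟩⟩
  · exact ⟨0, fun q => isEmptyElim q⟩
  -- Each constraint set is compact: its inequality bounds `‖v - u‖²` by an inner product with the
  -- fixed vector `a - (y - v)`. The finite case thus gives all constraints at once by the finite
  -- intersection property.
  let C : ι → Set X := fun q => {u | 0 ≤ inner ℝ (q.1.2 - (y - u)) (q.1.1 - u)}
  have hclosed : ∀ q, IsClosed (C q) := fun q => isClosed_le continuous_const (by fun_prop)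
  have hcomp : ∀ q, IsCompact (C q) := fun q => by
    refine (isCompact_closedBall q.1.1 ‖q.1.2 - (y - q.1.1)‖).of_isClosed_subset (hclosed q)
      fun u hu => ?_
    have hu : 0 ≤ inner ℝ (q.1.2 - (y - u)) (q.1.1 - u) := hu
    have e : q.1.2 - (y - u) = (q.1.2 - (y - q.1.1)) - (q.1.1 - u) := by abel
    rw [e, inner_sub_left, real_inner_self_eq_norm_sq] at hu
    have hcs := real_inner_le_norm (q.1.2 - (y - q.1.1)) (q.1.1 - u)
    rw [mem_closedBall_iff_norm']
    by_contra! hlt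
    have := (norm_nonneg (q.1.2 - (y - q.1.1))).trans_lt hlt
    nlinarith
  obtain ⟨u, -, hu⟩ := (hcomp q₀).inter_iInter_nonempty C hclosed fun S => by
    classical
    have : Nonempty {q // q ∈ insert q₀ S} := ⟨⟨q₀, Finset.mem_insert_self _ _⟩⟩
    obtain ⟨u, hu⟩ := exists_inner_add_nonneg_of_monotone_finite
      (ι := {q // q ∈ insert q₀ S}) (fun q => q.1.1.1) (fun q => q.1.1.2 - y)
      (fun i j => by simpa using hA.1 _ _ _ _ i.1.2 j.1.2)
    have hu' : ∀ q ∈ insert q₀ S, u ∈ C q := fun q hq => by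
      have := hu ⟨q, hq⟩
      simp only at this
      rwa [sub_add] at this
    exact ⟨u, hu' _ (Finset.mem_insert_self _ _),
      mem_iInter₂.2 fun q hq => hu' q (Finset.mem_insert_of_mem hq)⟩
  exact ⟨u, mem_iInter.1 hu⟩

/-- Monotonicity gives `‖u - v‖² ≤ ⟪x - y, u - v⟫`, then Cauchy–Schwarz applies. This yields both
uniqueness and nonexpansiveness of the resolvent. -/
theorem IsMonotoneOp.norm_sub_le_of_sub_mem {A : X → Set X} (hA : IsMonotoneOp A) {x y u v : X}
    (hu : x - u ∈ A u) (hv : y - v ∈ A v) : ‖u - v‖ ≤ ‖x - y‖ := by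
  have h := hA _ _ _ _ hu hv
  have e : x - u - (y - v) = (x - y) - (u - v) := by abel
  rw [e, inner_sub_left, real_inner_self_eq_norm_sq] at h
  have hcs := real_inner_le_norm (x - y) (u - v)
  by_contra! hlt
  have := (norm_nonneg (x - y)).trans_lt hlt
  nlinarith

theorem mem_singleton_add_iff_sub_mem {G : Type*} [AddCommGroup G] {S : Set G} {x u : G} :
    x ∈ ({u} : Set G) + S ↔ x - u ∈ S := by
  rw [singleton_add, image_add_left, mem_preimage, neg_add_eq_sub]

theorem IsMaximalMonotoneOp.opResolvent_eq_iff [FiniteDimensional ℝ X] {A : X → Set X}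
    (hA : IsMaximalMonotoneOp A) {x u : X} : opResolvent A x = u ↔ x - u ∈ A u := by
  have hspec : x - opResolvent A x ∈ A (opResolvent A x) := by
    obtain ⟨v, hv⟩ := hA.exists_sub_mem x
    exact mem_singleton_add_iff_sub_mem.1
      (Classical.epsilon_spec (p := fun u => x ∈ ({u} : Set X) + A u)
        ⟨v, mem_singleton_add_iff_sub_mem.2 hv⟩)
  refine ⟨fun h => h ▸ hspec, fun h => ?_⟩
  simpa [sub_eq_zero] using hA.1.norm_sub_le_of_sub_mem hspec h

theorem IsMaximalMonotoneOp.norm_opResolvent_sub_le [FiniteDimensional ℝ X] {A : X → Set X}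
    (hA : IsMaximalMonotoneOp A) (x y : X) : ‖opResolvent A x - opResolvent A y‖ ≤ ‖x - y‖ :=
  hA.1.norm_sub_le_of_sub_mem (hA.opResolvent_eq_iff.1 rfl) (hA.opResolvent_eq_iff.1 rfl)

/-- The zeros of the sum of a maximal monotone operator and a monotone map are the fixed points of
the forward-backward map. -/
theorem IsMaximalMonotoneOp.opResolvent_forward_eq_iff [FiniteDimensional ℝ X] {A : X → Set X}
    (hA : IsMaximalMonotoneOp A) {γ : ℝ} (hγ : 0 < γ) {x b : X} :
    opResolvent (fun u => γ • A u) (x - γ • b) = x ↔ -b ∈ A x := by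
  rw [(hA.smul hγ).opResolvent_eq_iff, sub_sub_cancel_left, ← smul_neg,
    smul_mem_smul_set_iff₀ hγ.ne']

/-- Banach's fixed point theorem on a closed ball. -/
theorem exists_fixedPoint_mem_closedBall {Y : Type*} [MetricSpace Y] [CompleteSpace Y]
    {f : Y → Y} {a : Y} {r k : ℝ} (hr : 0 ≤ r) (hk0 : 0 ≤ k) (hk : k < 1)
    (hf : ∀ x ∈ Metric.closedBall a r, ∀ y ∈ Metric.closedBall a r,
      dist (f x) (f y) ≤ k * dist x y)
    (ha : dist (f a) a ≤ (1 - k) * r) : ∃ x ∈ Metric.closedBall a r, f x = x := by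
  have haa : a ∈ Metric.closedBall a r := Metric.mem_closedBall_self hr
  have hmaps : MapsTo f (Metric.closedBall a r) (Metric.closedBall a r) := fun x hx => by
    rw [Metric.mem_closedBall] at *
    calc dist (f x) a ≤ dist (f x) (f a) + dist (f a) a := dist_triangle _ _ _
      _ ≤ k * dist x a + (1 - k) * r := add_le_add (hf x hx a haa) ha
      _ ≤ k * r + (1 - k) * r := by gcongr
      _ = r := by ring
  obtain ⟨x, hx, hfx, -⟩ := ContractingWith.exists_fixedPoint' (K := ⟨k, hk0⟩)
    Metric.isClosed_closedBall.isComplete hmaps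
    ⟨by exact_mod_cast hk, LipschitzWith.of_dist_le_mul fun x y => hf x x.2 y y.2⟩ haa
    (edist_ne_top _ _)
  exact ⟨x, hx, hfx⟩

/-- If a zero of `A + B` is isolated then it is the only zero. -/
theorem IsMaximalMonotoneOp.zero_unique_of_isolated [FiniteDimensional ℝ X] {A : X → Set X}
    {B : X → X} (hA : IsMaximalMonotoneOp A) (hB : IsMonotoneOp fun x => {B x})
    (hlip : LocallyLipschitz B) {x x' : X} (hx : -B x ∈ A x) (hx' : -B x' ∈ A x')
    (hiso : ∀ᶠ z in 𝓝 x, -B z ∈ A z → z = x) : x' = x := by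
  obtain ⟨L, s, hs, hL⟩ := hlip x
  obtain ⟨r, hr, hball⟩ := Metric.nhds_basis_closedBall.mem_iff.1 hs
  -- A step this small makes `w ↦ opResolvent (l A) (z - l • B w)` a contraction near `x`; the
  -- original `γ` need not be small enough.
  obtain ⟨l, hl, hlL⟩ : ∃ l : ℝ, 0 < l ∧ l * L < 1 := by
    refine ⟨1 / (L + 1), by positivity, ?_⟩
    rw [div_mul_eq_mul_div, one_mul, div_lt_one (by positivity)]
    linarith
  have hL0 : 0 ≤ l * L := by positivity
  have hzero : ∀ t ∈ Icc (0 : ℝ) 1, dist (x + t • (x' - x)) x ≤ (1 - l * L) * r →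
      -B (x + t • (x' - x)) ∈ A (x + t • (x' - x)) := by
    intro t ht hd
    set z := x + t • (x' - x) with hz
    have hne := (hA.smul hl).norm_opResolvent_sub_le
    have hfx : opResolvent (fun u => l • A u) (x - l • B x) = x :=
      (hA.opResolvent_forward_eq_iff hl).2 hx
    -- The fixed point `w` plays the resolvent of `l (A + B)` at `z`, without any maximality of the
    -- sum. The centre `x` is fixed when `z = x`, so it is displaced by at most `dist z x`.
    obtain ⟨w, -, hw⟩ := exists_fixedPoint_mem_closedBall
      (f := fun w => opResolvent (fun u => l • A u) (z - l • B w)) (a := x) hr.le hL0 hlL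
      (fun w₁ h₁ w₂ h₂ => by
        rw [dist_eq_norm]
        refine (hne _ _).trans ?_
        rw [sub_sub_sub_cancel_left, ← smul_sub, norm_smul, Real.norm_of_nonneg hl.le, mul_assoc,
          ← dist_eq_norm, dist_comm]
        exact mul_le_mul_of_nonneg_left (hL.dist_le_mul _ (hball h₁) _ (hball h₂)) hl.le)
      (by
        rw [dist_eq_norm]
        nth_rw 2 [← hfx]
        refine (hne _ _).trans ?_
        rwa [sub_sub_sub_cancel_right, ← dist_eq_norm])
    rw [(hA.smul hl).opResolvent_eq_iff] at hw
    obtain ⟨a, ha, hal⟩ := hw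
    have hal : l • a = z - l • B w - w := hal
    -- Pair `a + B w` with both zeros, then combine convexly: its inner product with `w - z` is
    -- nonnegative. But `l • (a + B w) = z - w`, hence `w = z`.
    have hx1 : 0 ≤ inner ℝ (a + B w) (w - x) := by
      have h1 := hA.1 _ _ _ _ ha hx
      have h2 := hB w x _ _ rfl rfl
      rw [← add_sub_cancel_right a (B w)] at h1
      simp only [inner_sub_left, inner_add_left, inner_neg_left] at *
      linarith
    have hx2 : 0 ≤ inner ℝ (a + B w) (w - x') := by
      have h1 := hA.1 _ _ _ _ ha hx'
      have h2 := hB w x' _ _ rfl rfl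
      simp only [inner_sub_left, inner_add_left, inner_neg_left] at *
      linarith
    have hx3 : 0 ≤ inner ℝ (a + B w) (w - z) := by
      have e : w - z = (1 - t) • (w - x) + t • (w - x') := by rw [hz]; module
      rw [e, inner_add_right, inner_smul_right, inner_smul_right]
      exact add_nonneg (mul_nonneg (sub_nonneg.2 ht.2) hx1) (mul_nonneg ht.1 hx2)
    have e2 : l • (a + B w) = -(w - z) := by rw [smul_add, hal]; abel
    have hx4 : 0 ≤ inner ℝ (l • (a + B w)) (w - z) := by
      rw [inner_smul_left]; exact mul_nonneg hl.le hx3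
    rw [e2, inner_neg_left, real_inner_self_eq_norm_sq] at hx4
    have hwz : w = z := by
      rw [← sub_eq_zero, ← norm_eq_zero]
      nlinarith [norm_nonneg (w - z)]
    rw [hwz, sub_self, neg_zero, smul_eq_zero] at e2
    rw [hwz] at ha
    rwa [← eq_neg_of_add_eq_zero_left (e2.resolve_left hl.ne')]
  have hline : Tendsto (fun t : ℝ => x + t • (x' - x)) (𝓝[>] 0) (𝓝 x) := by
    have : Continuous fun t : ℝ => x + t • (x' - x) := by fun_prop
    simpa using (this.tendsto 0).mono_left nhdsWithin_le_nhds
  have hpos : 0 < (1 - l * L) * r := mul_pos (sub_pos.2 hlL) hr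
  obtain ⟨t, ⟨ht1, ht2⟩, ht0, ht⟩ := ((hline.eventually (hiso.and
    (Metric.closedBall_mem_nhds x hpos))).and (Ioc_mem_nhdsGT (zero_lt_one (α := ℝ)))).exists
  have := ht1 (hzero t ⟨ht0.le, ht⟩ ht2)
  rw [add_eq_left, smul_eq_zero, sub_eq_zero] at this
  exact this.resolve_left ht0.ne'

end Monotone

/-! ### The forward-backward map and its fixed points -/

section ForwardBackward

theorem ContinuousLinearMap.isInvertible_id_sub_of_norm_lt_one {X : Type*} [NormedAddCommGroup X]
    [NormedSpace ℝ X] [CompleteSpace X] {K : X →L[ℝ] X} (hK : ‖K‖ < 1) :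
    (ContinuousLinearMap.id ℝ X - K).IsInvertible := by
  obtain ⟨u, hu⟩ := isUnit_one_sub_of_norm_lt_one hK
  exact ⟨ContinuousLinearEquiv.ofUnit u, hu⟩

variable {P X : Type*} [NormedAddCommGroup P] [NormedSpace ℝ P]
  [NormedAddCommGroup X] [InnerProductSpace ℝ X]
  {Θ : Set P} {γ : ℝ} {A : P × X → Set X} {B : P × X → X}

theorem isSolution_iff_neg_mem {θ : P} {x : X} : IsSolution A B θ x ↔ -B (θ, x) ∈ A (θ, x) := by
  rw [IsSolution, add_comm, mem_singleton_add_iff_sub_mem, zero_sub]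

/-- The map `H(θ, x) = T(θ, x - γ B_θ(x))`. -/
noncomputable def forwardBackward (γ : ℝ) (A : P × X → Set X) (B : P × X → X) (q : P × X) : X :=
  resolventMap γ A (q.1, q.2 - γ • B q)

theorem jacXH_eq_image (θ : P) (x : X) : jacXH γ A B θ x =
    (fun q : (P × X →L[ℝ] X) × (P × X →L[ℝ] X) =>
      (varBlock q.1).comp (ContinuousLinearMap.id ℝ X - γ • varBlock q.2)) ''
      (clarkeT γ A B θ x ×ˢ clarkeJacobian B (θ, x)) := by
  ext K
  constructor
  · rintro ⟨M, hM, N, hN, rfl⟩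
    exact ⟨(M, N), ⟨hM, hN⟩, rfl⟩
  · rintro ⟨⟨M, N⟩, ⟨hM, hN⟩, rfl⟩
    exact ⟨M, hM, N, hN, rfl⟩

theorem jacSol_eq_image (θ : P) (x : X) : jacSol γ A B θ x =
    (fun q : (P × X →L[ℝ] X) × (P × X →L[ℝ] X) => (solMatrix γ q.1 q.2).inverse.comp
      (parBlock q.1 - γ • (varBlock q.1).comp (parBlock q.2))) ''
      (clarkeT γ A B θ x ×ˢ clarkeJacobian B (θ, x)) := by
  ext K
  constructor
  · rintro ⟨M, hM, N, hN, rfl⟩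
    exact ⟨(M, N), ⟨hM, hN⟩, rfl⟩
  · rintro ⟨⟨M, N⟩, ⟨hM, hN⟩, rfl⟩
    exact ⟨M, hM, N, hN, rfl⟩

@[fun_prop]
theorem continuous_parBlock : Continuous (parBlock : (P × X →L[ℝ] X) → P →L[ℝ] X) := by
  unfold parBlock; fun_prop

@[fun_prop]
theorem continuous_varBlock : Continuous (varBlock : (P × X →L[ℝ] X) → X →L[ℝ] X) := by
  unfold varBlock; fun_prop

theorem apply_prodMk_eq (M : P × X →L[ℝ] X) (v : P) (w : X) :
    M (v, w) = parBlock M v + varBlock M w := by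
  simp [parBlock, varBlock, ← map_add]

theorem isInvertible_solMatrix_of_norm_lt [CompleteSpace X] {θ : P} {x : X}
    (h : ∀ K ∈ jacXH γ A B θ x, ‖K‖ < 1) {M N : P × X →L[ℝ] X} (hM : M ∈ clarkeT γ A B θ x)
    (hN : N ∈ clarkeJacobian B (θ, x)) : (solMatrix γ M N).IsInvertible :=
  ContinuousLinearMap.isInvertible_id_sub_of_norm_lt_one (h _ ⟨M, hM, N, hN, rfl⟩)

/-- The gap below 1 leaves room for a strict bound by `k < 1`, an open condition that upper
hemicontinuity can propagate. -/
theorem exists_jacXH_norm_lt {θ : P} {x : X} (h : (⨆ K ∈ jacXH γ A B θ x, ‖K‖ₑ) < 1) :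
    ∃ k : ℝ, 0 ≤ k ∧ k < 1 ∧ ∀ K ∈ jacXH γ A B θ x, ‖K‖ < k := by
  obtain ⟨k, hk, hk1⟩ := ENNReal.lt_iff_exists_nnreal_btwn.1 h
  refine ⟨k, k.2, by exact_mod_cast hk1, fun K hK => ?_⟩
  have : ‖K‖ₑ < k := (le_iSup₂ (f := fun (K : X →L[ℝ] X) (_ : K ∈ jacXH γ A B θ x) => ‖K‖ₑ)
    K hK).trans_lt hk
  rw [enorm_eq_nnnorm] at this
  exact_mod_cast this

variable [FiniteDimensional ℝ X]

theorem isSolution_iff_forwardBackward_eq (hγ : 0 < γ) {θ : P}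
    (hA : IsMaximalMonotoneOp fun x => A (θ, x)) {x : X} :
    IsSolution A B θ x ↔ forwardBackward γ A B (θ, x) = x := by
  rw [isSolution_iff_neg_mem]
  exact (hA.opResolvent_forward_eq_iff hγ).symm

theorem exists_lipschitzOnWith_forwardBackward (hΘ : IsOpen Θ)
    (hT : LocallyLipschitzOn (Θ ×ˢ univ) (resolventMap γ A))
    (hB : LocallyLipschitzOn (Θ ×ˢ univ) B) {θ : P} (hθ : θ ∈ Θ) (x : X) :
    ∃ L : NNReal, ∃ s ∈ 𝓝 (θ, x), LipschitzOnWith L (forwardBackward γ A B) s := by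
  have hU : IsOpen (Θ ×ˢ (univ : Set X)) := hΘ.prod isOpen_univ
  obtain ⟨K, s, hs, hK⟩ := hB.exists_lipschitzOnWith_nhds hU (a := (θ, x)) ⟨hθ, mem_univ _⟩
  obtain ⟨L, t, ht, hL⟩ := hT.exists_lipschitzOnWith_nhds hU
    (a := (θ, x - γ • B (θ, x))) ⟨hθ, mem_univ _⟩
  have hq := (LipschitzWith.prod_fst.lipschitzOnWith (s := s)).prodMk
    ((LipschitzWith.prod_snd.lipschitzOnWith (s := s)).sub
      ((lipschitzWith_smul γ).comp_lipschitzOnWith hK))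
  have hcont := hq.continuousOn.continuousAt hs
  exact ⟨_, _, inter_mem hs (hcont.preimage_mem_nhds ht),
    hL.comp (hq.mono inter_subset_left) fun y hy => hy.2⟩

variable [FiniteDimensional ℝ P]

/-- The chain rule for the forward-backward map, in terms of the Clarke Jacobians of its parts. -/
theorem ae_hasDerivAt_forwardBackward (hΘ : IsOpen Θ)
    (hT : PathDifferentiableOn (Θ ×ˢ univ) (resolventMap γ A))
    (hB : PathDifferentiableOn (Θ ×ˢ univ) B) {c : ℝ → P} {x : ℝ → X}
    (hc : AbsolutelyContinuousOnInterval c 0 1) (hx : AbsolutelyContinuousOnInterval x 0 1)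
    (hcΘ : ∀ t ∈ Icc (0 : ℝ) 1, c t ∈ Θ) :
    ∀ᵐ t ∂(volume.restrict (Icc (0 : ℝ) 1)),
      ∀ M ∈ clarkeT γ A B (c t) (x t), ∀ N ∈ clarkeJacobian B (c t, x t),
        HasDerivAt (fun τ => forwardBackward γ A B (c τ, x τ))
          (M (deriv c t, deriv x t - γ • N (deriv c t, deriv x t))) t := by
  have hU : IsOpen (Θ ×ˢ (univ : Set X)) := hΘ.prod isOpen_univ
  have hp := hc.prodMk hx
  have hpU : ∀ t ∈ Icc (0 : ℝ) 1, (c t, x t) ∈ Θ ×ˢ (univ : Set X) :=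
    fun t ht => ⟨hcΘ t ht, mem_univ _⟩
  have hBp := hB.1.comp_absolutelyContinuousOnInterval hp
    (by rwa [uIcc_of_le zero_le_one])
  have hq : AbsolutelyContinuousOnInterval (fun t => (c t, x t - γ • B (c t, x t))) 0 1 :=
    hc.prodMk (hx.sub (hBp.const_smul γ))
  filter_upwards [
    (hT.isConservativeJacobianOn_clarkeJacobian hU).chain_rule _ hq
      fun t ht => ⟨hcΘ t ht, mem_univ _⟩,
    (hB.isConservativeJacobianOn_clarkeJacobian hU).chain_rule _ hp hpU,
    hc.ae_differentiableAt_of_finiteDimensional, hx.ae_differentiableAt_of_finiteDimensional]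
    with t hTt hBt hct hxt M hM N hN
  have hpt := hct.hasDerivAt.prodMk hxt.hasDerivAt
  have hBN := hBt N hN
  rw [hpt.deriv] at hBN
  have hqt := hct.hasDerivAt.prodMk (hxt.hasDerivAt.sub (hBN.const_smul γ))
  have hTM := hTt M hM
  rwa [show deriv (fun t => (c t, x t - γ • B (c t, x t))) t = _ from hqt.deriv] at hTM

/-- Both `jacXH` and `jacSol` are images of this set of pairs, so their regularity reduces to
continuity of the matrix formulas. -/
theorem upperHemicontinuousAt_clarke_pair (hΘ : IsOpen Θ)
    (hT : LocallyLipschitzOn (Θ ×ˢ univ) (resolventMap γ A))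
    (hB : LocallyLipschitzOn (Θ ×ˢ univ) B) {θ : P} (hθ : θ ∈ Θ) (x : X) :
    IsCompact (clarkeT γ A B θ x ×ˢ clarkeJacobian B (θ, x)) ∧
    UpperHemicontinuousAt
      (fun q : P × X => clarkeT γ A B q.1 q.2 ×ˢ clarkeJacobian B q) (θ, x) := by
  have hU : IsOpen (Θ ×ˢ (univ : Set X)) := hΘ.prod isOpen_univ
  have hx : (θ, x) ∈ Θ ×ˢ (univ : Set X) := ⟨hθ, mem_univ _⟩
  have hy : (θ, x - γ • B (θ, x)) ∈ Θ ×ˢ (univ : Set X) := ⟨hθ, mem_univ _⟩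
  have hcont : ContinuousAt (fun q : P × X => (q.1, q.2 - γ • B q)) (θ, x) := by
    have : ContinuousAt B (θ, x) := hB.continuousOn.continuousAt (hU.mem_nhds hx)
    fun_prop
  have h1 : UpperHemicontinuousAt (fun q : P × X => clarkeT γ A B q.1 q.2) (θ, x) :=
    UpperHemicontinuousAt.comp_continuousAt (S := clarkeJacobian (resolventMap γ A))
      (upperHemicontinuousAt_clarkeJacobian hT hU hy) hcont
  exact ⟨(isCompact_clarkeJacobian hT hU hy).prod (isCompact_clarkeJacobian hB hU hx),
    h1.prod_of_isCompact (upperHemicontinuousAt_clarkeJacobian hB hU hx)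
      (isCompact_clarkeJacobian hT hU hy) (isCompact_clarkeJacobian hB hU hx)⟩

/-- A bound on the products `V (I - γ Z)` at one point makes the forward-backward map locally
contractive, uniformly in the parameter. -/
theorem exists_ball_forwardBackward_contracting (hΘ : IsOpen Θ)
    (hT : PathDifferentiableOn (Θ ×ˢ univ) (resolventMap γ A))
    (hB : PathDifferentiableOn (Θ ×ˢ univ) B) {θ₀ : P} (hθ₀ : θ₀ ∈ Θ) {x₀ : X} {k : ℝ}
    (hk : ∀ K ∈ jacXH γ A B θ₀ x₀, ‖K‖ < k) :
    ∃ r > 0, Metric.ball θ₀ r ⊆ Θ ∧ ∀ θ ∈ Metric.ball θ₀ r,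
      ∀ x ∈ Metric.closedBall x₀ r, ∀ y ∈ Metric.closedBall x₀ r,
        dist (forwardBackward γ A B (θ, x)) (forwardBackward γ A B (θ, y)) ≤ k * dist x y := by
  have hU : IsOpen (Θ ×ˢ (univ : Set X)) := hΘ.prod isOpen_univ
  have husc : UpperHemicontinuousAt (fun q : P × X => jacXH γ A B q.1 q.2) (θ₀, x₀) := by
    simp only [jacXH_eq_image]
    exact (upperHemicontinuousAt_clarke_pair hΘ hT.1 hB.1 hθ₀ x₀).2.image_of_continuousAt
      fun p _ => Continuous.continuousAt (by fun_prop)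
  have hev := husc.forall_isOpen {K | ‖K‖ < k} (isOpen_lt continuous_norm continuous_const) hk
  obtain ⟨r, hr, hball⟩ := Metric.nhds_basis_ball.mem_iff.1
    (hev.and (hU.mem_nhds ⟨hθ₀, mem_univ x₀⟩))
  rw [← ball_prod_same] at hball
  refine ⟨r / 2, half_pos hr, fun θ hθ => (hball
    (⟨Metric.ball_subset_ball (half_le_self hr.le) hθ, Metric.mem_ball_self hr⟩ :
      (θ, x₀) ∈ Metric.ball θ₀ r ×ˢ Metric.ball x₀ r)).2.1, fun θ hθ x hx y hy => ?_⟩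
  have hθr : θ ∈ Metric.ball θ₀ r := Metric.ball_subset_ball (half_le_self hr.le) hθ
  have hθΘ : θ ∈ Θ := (hball (⟨hθr, Metric.mem_ball_self hr⟩ :
      (θ, x₀) ∈ Metric.ball θ₀ r ×ˢ Metric.ball x₀ r)).2.1
  -- Freezing the parameter gives it zero velocity, so only `V (I - γ Z)` acts on `x - y` in the
  -- chain rule.
  have hc : AbsolutelyContinuousOnInterval (fun _ : ℝ => θ) 0 1 := by
    simpa using absolutelyContinuousOnInterval_add_smul θ 0 0 1
  have hline := absolutelyContinuousOnInterval_add_smul y (x - y) 0 1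
  have hlip : LocallyLipschitzOn (Θ ×ˢ univ) (forwardBackward γ A B) := fun q hq => by
    obtain ⟨L, s, hs, hL⟩ := exists_lipschitzOnWith_forwardBackward hΘ hT.1 hB.1 hq.1 q.2
    exact ⟨L, s, mem_nhdsWithin_of_mem_nhds hs, hL⟩
  have hg : AbsolutelyContinuousOnInterval
      (fun t : ℝ => forwardBackward γ A B (θ, y + t • (x - y))) 0 1 :=
    hlip.comp_absolutelyContinuousOnInterval (hc.prodMk hline) fun _ _ => ⟨hθΘ, mem_univ _⟩
  have := hg.norm_sub_le (C := k * dist x y) (by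
    filter_upwards [ae_hasDerivAt_forwardBackward hΘ hT hB hc hline fun _ _ => hθΘ,
      ae_restrict_mem measurableSet_Icc] with t ht htI
    have hmem : y + t • (x - y) ∈ Metric.ball x₀ r :=
      Metric.closedBall_subset_ball (half_lt_self hr)
        ((convex_closedBall x₀ (r / 2)).add_smul_sub_mem hy hx htI)
    obtain ⟨M, hM⟩ := clarkeJacobian_nonempty (x := (θ, y + t • (x - y) -
      γ • B (θ, y + t • (x - y)))) hT.1 hU ⟨hθΘ, mem_univ _⟩
    obtain ⟨N, hN⟩ := clarkeJacobian_nonempty (x := (θ, y + t • (x - y))) hB.1 hU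
      ⟨hθΘ, mem_univ _⟩
    have hlt : ‖(varBlock M).comp (ContinuousLinearMap.id ℝ X - γ • varBlock N)‖ < k :=
      (hball (⟨hθr, hmem⟩ : (θ, y + t • (x - y)) ∈ Metric.ball θ₀ r ×ˢ Metric.ball x₀ r)).1
        ⟨M, hM, N, hN, rfl⟩
    have hd : HasDerivAt (fun t : ℝ => y + t • (x - y)) (x - y) t := by
      simpa using ((hasDerivAt_id t).smul_const (x - y)).const_add y
    refine ⟨_, ht M hM N hN, ?_⟩
    rw [hd.deriv, deriv_const, apply_prodMk_eq, apply_prodMk_eq, map_zero, map_zero, zero_add,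
      zero_add, dist_eq_norm]
    exact ((varBlock M).comp (ContinuousLinearMap.id ℝ X - γ • varBlock N)).le_of_opNorm_le
      hlt.le (x - y))
  simpa [dist_eq_norm] using this

/-- Two fixed points in the contracting ball coincide, so `x` is isolated among solutions;
monotonicity makes this global. -/
theorem isSolution_unique_of_contractive (hΘ : IsOpen Θ) (hγ : 0 < γ)
    (hT : PathDifferentiableOn (Θ ×ˢ univ) (resolventMap γ A))
    (hB : PathDifferentiableOn (Θ ×ˢ univ) B) {θ : P} (hθ : θ ∈ Θ)
    (hA : IsMaximalMonotoneOp fun x => A (θ, x)) (hBm : IsMonotoneOp fun x => {B (θ, x)})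
    (hBlip : LocallyLipschitz fun x => B (θ, x)) {x x' : X} (hx : IsSolution A B θ x)
    (hcontr : (⨆ K ∈ jacXH γ A B θ x, ‖K‖ₑ) < 1) (hx' : IsSolution A B θ x') : x' = x := by
  obtain ⟨k, -, hk1, hk⟩ := exists_jacXH_norm_lt hcontr
  obtain ⟨r, hr, -, hcon⟩ := exists_ball_forwardBackward_contracting hΘ hT hB hθ hk
  refine hA.zero_unique_of_isolated hBm hBlip (isSolution_iff_neg_mem.1 hx)
    (isSolution_iff_neg_mem.1 hx') ?_
  filter_upwards [Metric.closedBall_mem_nhds x hr] with z hz hz0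
  have h := hcon θ (Metric.mem_ball_self hr) z hz x (Metric.mem_closedBall_self hr.le)
  rw [(isSolution_iff_forwardBackward_eq hγ hA).1 hx,
    (isSolution_iff_forwardBackward_eq hγ hA).1 (isSolution_iff_neg_mem.2 hz0)] at h
  rw [← dist_le_zero]
  nlinarith [dist_nonneg (x := z) (y := x)]

/-- The solution map is locally Lipschitz at a parameter where the forward-backward map is
contractive and near which solutions are unique. -/
theorem exists_lipschitzOnWith_solution (hΘ : IsOpen Θ) (hγ : 0 < γ)
    (hA : ∀ θ ∈ Θ, IsMaximalMonotoneOp fun x => A (θ, x))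
    (hT : PathDifferentiableOn (Θ ×ˢ univ) (resolventMap γ A))
    (hB : PathDifferentiableOn (Θ ×ˢ univ) B) {xstar : P → X}
    (hsol : ∀ θ ∈ Θ, IsSolution A B θ (xstar θ))
    (huniq : ∀ θ ∈ Θ, ∀ x, IsSolution A B θ x → x = xstar θ) {θ₀ : P} (hθ₀ : θ₀ ∈ Θ)
    (hcontr : (⨆ K ∈ jacXH γ A B θ₀ (xstar θ₀), ‖K‖ₑ) < 1) :
    ∃ C : NNReal, ∃ s ∈ 𝓝 θ₀, LipschitzOnWith C xstar s := by
  obtain ⟨k, hk0, hk1, hk⟩ := exists_jacXH_norm_lt hcontr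
  have hk1' : 0 < 1 - k := sub_pos.2 hk1
  obtain ⟨r₁, hr₁, hr₁Θ, hcon⟩ := exists_ball_forwardBackward_contracting hΘ hT hB hθ₀ hk
  obtain ⟨L, s, hs, hL⟩ := exists_lipschitzOnWith_forwardBackward hΘ hT.1 hB.1 hθ₀ (xstar θ₀)
  obtain ⟨r₂, hr₂, hball⟩ := Metric.nhds_basis_closedBall.mem_iff.1 hs
  rw [← closedBall_prod_same] at hball
  set r := min r₁ r₂ with hr_def
  have hr : 0 < r := lt_min hr₁ hr₂
  -- Moving the parameter by `δ` displaces `xstar θ₀` by at most `(1 - k) * r`, the amount Banach's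
  -- theorem on the ball allows; `L + 1` avoids division by zero.
  set δ := min r ((1 - k) * r / (L + 1)) with hδ_def
  have hδ : 0 < δ := lt_min hr (by positivity)
  have hδr : δ ≤ r := min_le_left _ _
  have hxr : ∀ x ∈ Metric.closedBall (xstar θ₀) r, x ∈ Metric.closedBall (xstar θ₀) r₁ :=
    fun x hx => Metric.closedBall_subset_closedBall (min_le_left _ _) hx
  have hθr₁ : ∀ θ ∈ Metric.ball θ₀ δ, θ ∈ Metric.ball θ₀ r₁ :=
    fun θ hθ => Metric.ball_subset_ball (hδr.trans (min_le_left _ _)) hθ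
  have hfix : ∀ θ ∈ Θ, forwardBackward γ A B (θ, xstar θ) = xstar θ :=
    fun θ hθ => (isSolution_iff_forwardBackward_eq hγ (hA θ hθ)).1 (hsol θ hθ)
  have hpar : ∀ θ ∈ Metric.ball θ₀ δ, ∀ θ' ∈ Metric.ball θ₀ δ,
      ∀ x ∈ Metric.closedBall (xstar θ₀) r,
      dist (forwardBackward γ A B (θ, x)) (forwardBackward γ A B (θ', x)) ≤ L * dist θ θ' := by
    have hmem : ∀ θ ∈ Metric.ball θ₀ δ, ∀ x ∈ Metric.closedBall (xstar θ₀) r, (θ, x) ∈ s :=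
      fun θ hθ x hx => hball ⟨Metric.closedBall_subset_closedBall
        (hδr.trans (min_le_right _ _)) (Metric.ball_subset_closedBall hθ),
        Metric.closedBall_subset_closedBall (min_le_right _ _) hx⟩
    intro θ hθ θ' hθ' x hx
    simpa [Prod.dist_eq] using hL.dist_le_mul _ (hmem θ hθ x hx) _ (hmem θ' hθ' x hx)
  -- Continuity of `xstar` is not known beforehand: the local fixed point is identified with `xstar
  -- θ` by global uniqueness.
  have hnear : ∀ θ ∈ Metric.ball θ₀ δ, xstar θ ∈ Metric.closedBall (xstar θ₀) r := by
    intro θ hθ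
    have hθΘ := hr₁Θ (hθr₁ θ hθ)
    obtain ⟨w, hw, hfw⟩ := exists_fixedPoint_mem_closedBall
      (f := fun x => forwardBackward γ A B (θ, x)) (a := xstar θ₀) hr.le hk0 hk1
      (fun x hx y hy => hcon θ (hθr₁ θ hθ) x (hxr x hx) y (hxr y hy)) (by
        nth_rw 2 [← hfix θ₀ hθ₀]
        refine (hpar θ hθ θ₀ (Metric.mem_ball_self hδ) _
          (Metric.mem_closedBall_self hr.le)).trans ?_
        have h1 : dist θ θ₀ ≤ (1 - k) * r / (L + 1) :=
          (Metric.mem_ball.1 hθ).le.trans (min_le_right _ _)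
        rw [le_div_iff₀ (by positivity)] at h1
        nlinarith [dist_nonneg (x := θ) (y := θ₀)])
    rwa [← huniq θ hθΘ w ((isSolution_iff_forwardBackward_eq hγ (hA θ hθΘ)).2 hfw)]
  refine ⟨(L / (1 - k)).toNNReal, Metric.ball θ₀ δ, Metric.ball_mem_nhds _ hδ,
    LipschitzOnWith.of_dist_le_mul fun θ hθ θ' hθ' => ?_⟩
  rw [Real.coe_toNNReal _ (by positivity), div_mul_eq_mul_div, le_div_iff₀ hk1']
  have h1 := hcon θ (hθr₁ θ hθ) _ (hxr _ (hnear θ hθ)) _ (hxr _ (hnear θ' hθ'))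
  have h2 := hpar θ hθ θ' hθ' _ (hnear θ' hθ')
  rw [hfix θ (hr₁Θ (hθr₁ θ hθ))] at h1
  rw [hfix θ' (hr₁Θ (hθr₁ θ' hθ'))] at h2
  linarith [dist_triangle (xstar θ) (forwardBackward γ A B (θ, xstar θ')) (xstar θ')]

/-- With velocities `v` of the parameter and `w` of the solution, the fixed point equation gives `w
= U v + V (w - γ (W v + Z w))`. This determines `w` since the matrix is invertible. -/
theorem isConservativeJacobianOn_jacSol (hΘ : IsOpen Θ)
    (hT : PathDifferentiableOn (Θ ×ˢ univ) (resolventMap γ A))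
    (hB : PathDifferentiableOn (Θ ×ˢ univ) B) {xstar : P → X}
    (hfix : ∀ θ ∈ Θ, forwardBackward γ A B (θ, xstar θ) = xstar θ)
    (hlip : LocallyLipschitzOn Θ xstar)
    (hinv : ∀ θ ∈ Θ, ∀ M ∈ clarkeT γ A B θ (xstar θ), ∀ N ∈ clarkeJacobian B (θ, xstar θ),
      (solMatrix γ M N).IsInvertible) :
    IsConservativeJacobianOn Θ xstar fun θ => jacSol γ A B θ (xstar θ) := by
  have hcX : CompleteSpace X := FiniteDimensional.complete ℝ X
  have hU : IsOpen (Θ ×ˢ (univ : Set X)) := hΘ.prod isOpen_univ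
  have hcont : ∀ θ ∈ Θ, ∀ q ∈ clarkeT γ A B θ (xstar θ) ×ˢ clarkeJacobian B (θ, xstar θ),
      ContinuousAt (fun q : (P × X →L[ℝ] X) × (P × X →L[ℝ] X) =>
        (solMatrix γ q.1 q.2).inverse.comp
          (parBlock q.1 - γ • (varBlock q.1).comp (parBlock q.2))) q := by
    intro θ hθ q hq
    have h1 : Continuous fun q : (P × X →L[ℝ] X) × (P × X →L[ℝ] X) => solMatrix γ q.1 q.2 := by
      unfold solMatrix; fun_prop
    have h2 : ContinuousAt (fun q : (P × X →L[ℝ] X) × (P × X →L[ℝ] X) =>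
        (solMatrix γ q.1 q.2).inverse) q :=
      ContinuousAt.comp (g := ContinuousLinearMap.inverse)
        (hinv θ hθ q.1 hq.1 q.2 hq.2 |>.contDiffAt_map_inverse (𝕜 := ℝ) (n := 0)).continuousAt
        h1.continuousAt
    exact h2.clm_comp (Continuous.continuousAt (by fun_prop))
  simp only [jacSol_eq_image]
  refine .of_upperHemicontinuousAt (fun θ hθ => ?_) (fun θ hθ => ?_) (fun θ hθ => ?_)
    fun c hc hcΘ => ?_
  · exact ((clarkeJacobian_nonempty hT.1 hU ⟨hθ, mem_univ _⟩).prod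
      (clarkeJacobian_nonempty hB.1 hU ⟨hθ, mem_univ _⟩)).image _
  · exact (upperHemicontinuousAt_clarke_pair hΘ hT.1 hB.1 hθ _).1.image_of_continuousOn
      fun q hq => (hcont θ hθ q hq).continuousWithinAt
  · have hx : ContinuousAt (fun θ => (θ, xstar θ)) θ :=
      continuousAt_id.prodMk (hlip.continuousOn.continuousAt (hΘ.mem_nhds hθ))
    exact (UpperHemicontinuousAt.comp_continuousAt (g := fun θ => (θ, xstar θ))
      (upperHemicontinuousAt_clarke_pair hΘ hT.1 hB.1 hθ (xstar θ)).2 hx).image_of_continuousAt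
      (hcont θ hθ)
  · have hx : AbsolutelyContinuousOnInterval (fun t => xstar (c t)) 0 1 :=
      hlip.comp_absolutelyContinuousOnInterval hc (by rwa [uIcc_of_le zero_le_one])
    -- The fixed point identity is available only for times in `[0, 1]`; dropping the endpoints
    -- makes it hold on a neighbourhood of `t`.
    have hmem : ∀ᵐ t ∂(volume.restrict (Icc (0 : ℝ) 1)), t ∈ Ioo (0 : ℝ) 1 := by
      rw [← restrict_Ioo_eq_restrict_Icc]
      exact ae_restrict_mem measurableSet_Ioo
    filter_upwards [ae_hasDerivAt_forwardBackward hΘ hT hB hc hx hcΘ,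
      hx.ae_differentiableAt_of_finiteDimensional, hmem] with t ht hxt htI
    rintro _ ⟨⟨M, N⟩, ⟨hM, hN⟩, rfl⟩
    have hloc : (fun τ => xstar (c τ)) =ᶠ[𝓝 t]
        fun τ => forwardBackward γ A B (c τ, xstar (c τ)) := by
      filter_upwards [Icc_mem_nhds htI.1 htI.2] with τ hτ using (hfix _ (hcΘ τ hτ)).symm
    have hd := hxt.hasDerivAt.unique ((ht M hM N hN).congr_of_eventuallyEq hloc)
    have hinvMN := hinv _ (hcΘ t (Ioo_subset_Icc_self htI)) M hM N hN
    set v := deriv c t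
    set w := deriv (fun t => xstar (c t)) t
    have hw : solMatrix γ M N w =
        (parBlock M - γ • (varBlock M).comp (parBlock N)) v := by
      rw [apply_prodMk_eq, apply_prodMk_eq] at hd
      have e : w - varBlock M (w - γ • varBlock N w) =
          parBlock M v - γ • varBlock M (parBlock N v) := by
        nth_rw 1 [hd]
        simp only [map_sub, map_smul, map_add, smul_add]
        abel
      simpa [solMatrix] using e
    have hwv : w = ((solMatrix γ M N).inverse.comp
        (parBlock M - γ • (varBlock M).comp (parBlock N))) v := by
      rw [ContinuousLinearMap.comp_apply, ← hw, hinvMN.inverse_apply_self]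
    rw [show ((solMatrix γ M N).inverse.comp
        (parBlock M - γ • (varBlock M).comp (parBlock N))) v = w from hwv.symm]
    exact hxt.hasDerivAt

end ForwardBackward

theorem lemma3p3 (p n : ℕ)
    (Θ : Set (EuclideanSpace ℝ (Fin p))) (hΘ_open : IsOpen Θ) (hΘ_conn : IsConnected Θ)
    (A : EuclideanSpace ℝ (Fin p) × EuclideanSpace ℝ (Fin n) → Set (EuclideanSpace ℝ (Fin n)))
    (B : EuclideanSpace ℝ (Fin p) × EuclideanSpace ℝ (Fin n) → EuclideanSpace ℝ (Fin n))
    (γ : ℝ) (hγ : 0 < γ)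
    (hA : ∀ θ ∈ Θ, IsMaximalMonotoneOp fun x => A (θ, x))
    (hB : ∀ θ ∈ Θ, IsMaximalMonotoneOp fun x => {B (θ, x)})
    (hB_lip : ∀ θ ∈ Θ, LocallyLipschitz fun x => B (θ, x))
    (h_sol : ∀ θ ∈ Θ, ∃ x, IsSolution A B θ x)
    (hT_path : PathDifferentiableOn (Θ ×ˢ univ) (resolventMap γ A))
    (hB_path : PathDifferentiableOn (Θ ×ˢ univ) B)
    (h_contr : IsContractive Θ γ A B) :
    (∀ θ ∈ Θ, ∃! x, IsSolution A B θ x) ∧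
    ∀ xstar : EuclideanSpace ℝ (Fin p) → EuclideanSpace ℝ (Fin n),
      (∀ θ ∈ Θ, IsSolution A B θ (xstar θ)) →
        PathDifferentiableOn Θ xstar ∧
        (∀ θ ∈ Θ, ∀ M ∈ clarkeT γ A B θ (xstar θ), ∀ N ∈ clarkeJacobian B (θ, xstar θ),
          (solMatrix γ M N).IsInvertible) ∧
        IsConservativeJacobianOn Θ xstar fun θ => jacSol γ A B θ (xstar θ) := by
  have huniq : ∀ θ ∈ Θ, ∃ x, IsSolution A B θ x ∧ (⨆ K ∈ jacXH γ A B θ x, ‖K‖ₑ) < 1 ∧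
      ∀ x', IsSolution A B θ x' → x' = x := fun θ hθ => by
    obtain ⟨x, hx, hc⟩ := h_contr θ hθ
    exact ⟨x, hx, hc, fun x' hx' => isSolution_unique_of_contractive hΘ_open hγ hT_path hB_path
      hθ (hA θ hθ) (hB θ hθ).1 (hB_lip θ hθ) hx hc hx'⟩
  refine ⟨fun θ hθ => ?_, fun xstar hsol => ?_⟩
  · obtain ⟨x, hx, -, hu⟩ := huniq θ hθ
    exact ⟨x, hx, hu⟩
  -- Contractivity is assumed at some solution; uniqueness transports it to `xstar θ`.
  have hstar : ∀ θ ∈ Θ, (⨆ K ∈ jacXH γ A B θ (xstar θ), ‖K‖ₑ) < 1 ∧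
      ∀ x', IsSolution A B θ x' → x' = xstar θ := fun θ hθ => by
    obtain ⟨x, -, hc, hu⟩ := huniq θ hθ
    rw [hu _ (hsol θ hθ)]
    exact ⟨hc, hu⟩
  have hinv : ∀ θ ∈ Θ, ∀ M ∈ clarkeT γ A B θ (xstar θ), ∀ N ∈ clarkeJacobian B (θ, xstar θ),
      (solMatrix γ M N).IsInvertible := fun θ hθ M hM N hN => by
    obtain ⟨k, -, hk1, hk⟩ := exists_jacXH_norm_lt (hstar θ hθ).1
    exact isInvertible_solMatrix_of_norm_lt (fun K hK => (hk K hK).trans hk1) hM hN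
  have hlip : LocallyLipschitzOn Θ xstar := fun θ hθ => by
    obtain ⟨C, s, hs, hC⟩ := exists_lipschitzOnWith_solution hΘ_open hγ hA hT_path hB_path hsol
      (fun θ hθ => (hstar θ hθ).2) hθ (hstar θ hθ).1
    exact ⟨C, s, mem_nhdsWithin_of_mem_nhds hs, hC⟩
  have hcons := isConservativeJacobianOn_jacSol hΘ_open hT_path hB_path
    (fun θ hθ => (isSolution_iff_forwardBackward_eq hγ (hA θ hθ)).1 (hsol θ hθ)) hlip hinv
  exact ⟨⟨hlip, _, hcons⟩, hinv, hcons⟩
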